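/- Let $T>0$, $1<p<\infty$ and $0<\alpha\le 1$ with $\frac1p+\alpha>1$. Let $\mathrm{Conv}(\mathbb R^d)$ be the family of nonempty compact convex subsets of $\mathbb R^d$ with the Hausdorff metric $H$ and Minkowski addition, and put $\|A\|=H(A,\{0\})$. For a metric space $(E,\rho)$, $BV_p(E)$ is the set of $f:[0,T]\to E$ with finite Riesz $p$-variation $$V_p(f)=\sup_{0=t_0<\dots<t_n=T}\ \sum_{i=1}^n\frac{\rho(f(t_{i-1}),f(t_i))^p}{(t_i-t_{i-1})^{p-1}},$$ and, for a normed space $X$, $C^\alpha(X)$ is the space of $f:[0,T]\to X$ with finite norm $\|f\|_\alpha=\sup_{t}\|f(t)\|+\sup_{s<t}\frac{\|f(t)-f(s)\|}{(t-s)^\alpha}$. A function $F:[0,T]\to\mathrm{Conv}(\mathbb R^d)$ is Hukuhara differentiable if for every $t\in[0,T]$ there is $D_HF(t)\in\mathrm{Conv}(\mathbb R^d)$ which is the limit, as $h\to0^+$, of $\frac1h\,(F(t+h)\div F(t))$ (if $t<T$) and of $\frac1h\,(F(t)\div F(t-h))$ (if $t>0$), where $A\div B$ denotes the set $C\in\mathrm{Conv}(\mathbb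 R^d)$ with $A=B+C$, required to exist for all small $h>0$. The derivative is $p$-integrably bounded if $\|D_HF(t)\|\le k(t)$ for a.e. $t\in[0,T]$ with some $k\in L^p([0,T])$. Let $$\mathcal{IS}(F)=\{f\in BV_p(\mathbb R^d):\ f(t)\in F(t)\ \text{for all } t\in[0,T],\ f'\in L^p([0,T]),\ f'(t)\in D_HF(t)\ \text{for a.e. } t\in[0,T]\}.$$ For $g\in C^\alpha(\mathbb R)$ and $0\le s\le t\le T$ let $\int_s^t f\,dg$ be the limit of the Riemann sums $\sum_i f(t_{i-1})(g(t_i)-g(t_{i-1}))$ over partitions of $[s,t]$ with mesh tending to $0$. Let $(\mathcal{IS})\int_s^tF\,dg$ be the closure in $\mathbb R^d$ of $\{\int_s^tf\,dg: f\in\mathcal{IS}(F)\}$, and let $(\mathcal{IS})\int_0^{\cdot}F\,dg$ be the closure in $\|\cdot\|_\alpha$ of $\{\int_0^{\cdot}f\,dg: f\in\mathcal{IS}(F)\}$. Let $g\in C^\alpha(\mathbb R)$ and let $F,F_1,F_2\in BV_p(\mathrm{Conv}(\mathbb R^d))$ be Hukuhara differentiable with $p$-integrably bounded Hukuhara derivatives.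 Then the integral $\int_s^tf\,dg$ exists for every $f\in\mathcal{IS}(F)$ and all $0\le s\le t\le T$, the function $F_1+F_2$ belongs to $BV_p(\mathrm{Conv}(\mathbb R^d))$ and is Hukuhara differentiable, and $$(\mathcal{IS})\int_0^t(F_1+F_2)\,dg=(\mathcal{IS})\int_0^tF_1\,dg+(\mathcal{IS})\int_0^tF_2\,dg\qquad\text{for every }t\in[0,T].$$ Moreover, if $F(0)$ is bounded in $\mathbb R^d$ (which always holds, since $F(0)$ is compact), then $(\mathcal{IS})\int_0^{\cdot}F\,dg$ is a bounded set in $C^\alpha(\mathbb R^d)$, and $(\mathcal{IS})\int_s^tF\,dg$ is a bounded set in $\mathbb R^d$ for all $0\le s\le t\le T$. -/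

import Mathlib

open Set Filter Topology MeasureTheory
open scoped ENNReal NNReal Pointwise

noncomputable section

namespace SetYoung

/-- A finite partition `a = t₀ < t₁ < ⋯ < tₙ = b` of `[a, b]`
(only the values `pt 0, …, pt n` matter). -/
structure IntervalPartition (a b : ℝ) where
  n : ℕ
  pt : ℕ → ℝ
  pt_zero : pt 0 = a
  pt_last : pt n = b
  pt_lt : ∀ i < n, pt i < pt (i + 1)

/-- The Riesz `p`-variation of `f` on `[a, b]`, with values in `[0, ∞]`. -/
def rieszVar {M : Type*} [PseudoEMetricSpace M] (p : ℝ) (f : ℝ → M) (a b : ℝ) : ℝ≥0∞ :=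
  ⨆ P : IntervalPartition a b, ∑ i ∈ Finset.range P.n,
    edist (f (P.pt i)) (f (P.pt (i + 1))) ^ p /
      ENNReal.ofReal ((P.pt (i + 1) - P.pt i) ^ (p - 1))

/-- `f ∈ BV_p([0, T], M)`. Functions on `[0, T]` are represented by functions on `ℝ` of which only
the restriction to `[0, T]` is used. -/
def MemBV {M : Type*} [PseudoEMetricSpace M] (p T : ℝ) (f : ℝ → M) : Prop :=
  rieszVar p f 0 T < ⊤

/-- The Hölder norm `‖f‖_β = ‖f‖_∞ + M_β(f)` on `[0, T]`, with values in `[0, ∞]`. -/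
def holderNorm {X : Type*} [NormedAddCommGroup X] (T β : ℝ) (f : ℝ → X) : ℝ≥0∞ :=
  (⨆ t ∈ Icc 0 T, ‖f t‖ₑ) +
    ⨆ s ∈ Icc 0 T, ⨆ t ∈ Icc 0 T, ⨆ _ : s < t,
      ‖f t - f s‖ₑ / ENNReal.ofReal ((t - s) ^ β)

/-- `f ∈ C^β(X)`: the Hölder norm on `[0, T]` is finite. -/
def MemHolder {X : Type*} [NormedAddCommGroup X] (T β : ℝ) (f : ℝ → X) : Prop :=
  holderNorm T β f < ⊤

section Convex

variable {X : Type*} [NormedAddCommGroup X] [NormedSpace ℝ X]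

/-- `D` is the Hukuhara derivative at `t` of `F : [0, T] → Conv(X)`. `ConvexBody X` is the space of
nonempty compact convex sets with the Minkowski operations and the Hausdorff metric; `C h` is the
Hukuhara difference `F (t + h) ÷ F t`, respectively `F t ÷ F (t - h)`. At the endpoints of `[0, T]`
only the one-sided limit that makes sense is required. -/
def HasHukuharaDerivAt (T : ℝ) (F : ℝ → ConvexBody X) (t : ℝ) (D : ConvexBody X) : Prop :=
  (t < T → ∃ C : ℝ → ConvexBody X,
    (∀ᶠ h in 𝓝[>] (0 : ℝ), F (t + h) = F t + C h) ∧
      Tendsto (fun h : ℝ => h⁻¹ • C h) (𝓝[>] 0) (𝓝 D)) ∧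
  (0 < t → ∃ C : ℝ → ConvexBody X,
    (∀ᶠ h in 𝓝[>] (0 : ℝ), F t = F (t - h) + C h) ∧
      Tendsto (fun h : ℝ => h⁻¹ • C h) (𝓝[>] 0) (𝓝 D))

/-- `F` is Hukuhara differentiable at every point of `[0, T]`. -/
def HukuharaDifferentiable (T : ℝ) (F : ℝ → ConvexBody X) : Prop :=
  ∀ t ∈ Icc 0 T, ∃ D, HasHukuharaDerivAt T F t D

open Classical in
/-- The Hukuhara derivative `D_H F` (with the value `{0}` where it does not exist). -/
def hukuharaDeriv (T : ℝ) (F : ℝ → ConvexBody X) (t : ℝ) : ConvexBody X :=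
  if h : ∃ D, HasHukuharaDerivAt T F t D then h.choose else 0

/-- `Φ` is `p`-integrably bounded on `[0, T]`: `‖Φ t‖ = H(Φ t, {0}) ≤ k t` for almost all `t`, with
some `k ∈ L^p([0, T])`. -/
def PIntegrablyBounded (p T : ℝ) (Φ : ℝ → ConvexBody X) : Prop :=
  ∃ k : ℝ → ℝ, MemLp k (ENNReal.ofReal p) (volume.restrict (Icc 0 T)) ∧
    ∀ᵐ t ∂(volume.restrict (Icc 0 T)), dist (Φ t) 0 ≤ k t

/-- `S_{V_p}(F)`: the selections of `F` with bounded Riesz `p`-variation. -/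
def selV (p T : ℝ) (F : ℝ → ConvexBody X) : Set (ℝ → X) :=
  {f | MemBV p T f ∧ ∀ t ∈ Icc 0 T, f t ∈ F t}

/-- `S_{L^p}(Φ)`: the `p`-integrable almost everywhere selections of `Φ`. -/
def selL (p T : ℝ) (Φ : ℝ → ConvexBody X) : Set (ℝ → X) :=
  {φ | MemLp φ (ENNReal.ofReal p) (volume.restrict (Icc 0 T)) ∧
    ∀ᵐ t ∂(volume.restrict (Icc 0 T)), φ t ∈ Φ t}

/-- `IS(F)`: the selections `f ∈ S_{V_p}(F)` with `f' ∈ S_{L^p}(D_H F)`. -/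
def IS (p T : ℝ) (F : ℝ → ConvexBody X) : Set (ℝ → X) :=
  {f | f ∈ selV p T F ∧ deriv f ∈ selL p T (hukuharaDeriv T F)}

/-- `I` is the Young integral `∫_s^t f dg`: the limit of the left-point Riemann sums as the mesh of
the partition of `[s, t]` tends to `0`. -/
def HasYoungIntegral (f : ℝ → X) (g : ℝ → ℝ) (s t : ℝ) (I : X) : Prop :=
  ∀ ε > 0, ∃ δ > 0, ∀ P : IntervalPartition s t,
    (∀ i < P.n, P.pt (i + 1) - P.pt i < δ) →
      ‖∑ i ∈ Finset.range P.n, (g (P.pt (i + 1)) - g (P.pt i)) • f (P.pt i) - I‖ < ε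

/-- The set-valued Young integral `(IS)∫_s^t F dg`: the closure of `{∫_s^t f dg : f ∈ IS(F)}`. -/
def setYoung (p T : ℝ) (F : ℝ → ConvexBody X) (g : ℝ → ℝ) (s t : ℝ) : Set X :=
  closure {I | ∃ f ∈ IS p T F, HasYoungIntegral f g s t I}

/-- The set of paths `(IS)∫_0^· F dg`: the closure, in the norm of `C^α(X)`, of the set of the
indefinite integrals `k = ∫_0^· f dg` on `[0, T]`, `f ∈ IS(F)`. -/
def setYoungPath (p T α : ℝ) (F : ℝ → ConvexBody X) (g : ℝ → ℝ) : Set (ℝ → X) :=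
  {h | ∀ ε > 0, ∃ f ∈ IS p T F, ∃ k : ℝ → X,
    (∀ t ∈ Icc 0 T, HasYoungIntegral f g 0 t (k t)) ∧ holderNorm T α (h - k) < ε}

end Convex

end SetYoung

end

/-!
A selection `f ∈ IS(F)` is absolutely continuous: a finite Riesz `p`-variation with `p > 1` forces
it, and therefore `f` is the integral of `f'`. Integration by parts then produces `∫_s^t f dg` for
every continuous `g`, together with the bound
`‖∫_s^t f dg‖ ≤ sup_{u ∈ [s, t]} |g u - g t| * (‖f s‖ + ∫_s^t ‖f'‖)`. The second factor is bounded
by `‖F 0‖ + ‖k‖_{L¹}`, uniformly in `f`, and this gives the boundedness statements.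

For additivity, a convex body is read through its support function, which is additive and
determines it. The support functions of `F` are differentiable with the support functions of
`D_H F` as derivatives, so `D_H (F₁ + F₂) = D_H F₁ + D_H F₂`, and by Hahn–Banach `x + ∫_0^· φ` is a
selection of `F` whenever `x ∈ F 0` and `φ` is a selection of `D_H F`. Given `f ∈ IS(F₁ + F₂)`, the
Kuratowski–Ryll-Nardzewski theorem splits `f'` measurably into a selection of `D_H F₁` plus one of
`D_H F₂`; integrating the two pieces writes `f` as a sum of elements of `IS(F₁)` and `IS(F₂)`.
-/

noncomputable section

namespace SetYoung

section SupportFunction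

variable {E : Type*} [NormedAddCommGroup E] [NormedSpace ℝ E] {K L : ConvexBody E}
  {ξ : StrongDual ℝ E} {x : E} {r : ℝ}

/-- The support function `ξ ↦ max {ξ x : x ∈ K}` of a convex body `K`. It lives on the dual space,
so that no inner product is needed. -/
def supportFun (K : ConvexBody E) (ξ : StrongDual ℝ E) : ℝ :=
  sSup (ξ '' K)

lemma le_supportFun (ξ : StrongDual ℝ E) (hx : x ∈ K) : ξ x ≤ supportFun K ξ :=
  le_csSup (K.isCompact.image ξ.continuous).bddAbove (mem_image_of_mem ξ hx)

lemma exists_mem_eq_supportFun (K : ConvexBody E) (ξ : StrongDual ℝ E) :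
    ∃ x ∈ K, ξ x = supportFun K ξ :=
  (K.isCompact.image ξ.continuous).sSup_mem (K.nonempty.image ξ)

lemma supportFun_le_iff : supportFun K ξ ≤ r ↔ ∀ x ∈ K, ξ x ≤ r := by
  rw [supportFun, csSup_le_iff (K.isCompact.image ξ.continuous).bddAbove (K.nonempty.image ξ),
    forall_mem_image]
  rfl

lemma supportFun_zero (ξ : StrongDual ℝ E) : supportFun 0 ξ = 0 := by
  simp [supportFun]

lemma supportFun_add (K L : ConvexBody E) (ξ : StrongDual ℝ E) :
    supportFun (K + L) ξ = supportFun K ξ + supportFun L ξ := by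
  apply le_antisymm
  · rw [supportFun_le_iff]
    rintro _ ⟨a, ha, b, hb, rfl⟩
    simpa only [map_add] using add_le_add (le_supportFun ξ ha) (le_supportFun ξ hb)
  · obtain ⟨a, ha, ha'⟩ := exists_mem_eq_supportFun K ξ
    obtain ⟨b, hb, hb'⟩ := exists_mem_eq_supportFun L ξ
    rw [← ha', ← hb', ← map_add]
    exact le_supportFun ξ (add_mem_add ha hb)

lemma supportFun_smul (hr : 0 ≤ r) (K : ConvexBody E) (ξ : StrongDual ℝ E) :
    supportFun (r • K) ξ = r * supportFun K ξ := by
  apply le_antisymm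
  · rw [supportFun_le_iff]
    rintro _ ⟨a, ha, rfl⟩
    simpa only [map_smul, smul_eq_mul] using mul_le_mul_of_nonneg_left (le_supportFun ξ ha) hr
  · obtain ⟨a, ha, ha'⟩ := exists_mem_eq_supportFun K ξ
    rw [← ha', ← smul_eq_mul, ← map_smul]
    exact le_supportFun ξ (smul_mem_smul_set ha)

lemma mul_norm_le_of_forall_ball_apply_le {u : ℝ} (hr : 0 < r)
    (h : ∀ y ∈ Metric.ball x r, ξ y ≤ u) : r * ‖ξ‖ ≤ u - ξ x := by
  suffices ‖ξ‖ ≤ (u - ξ x) / r by rwa [le_div_iff₀' hr] at this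
  refine le_of_forall_lt fun c hc => ?_
  obtain ⟨z, hz, hcz⟩ := ξ.exists_lt_apply_of_lt_opNorm hc
  have hball : ∀ w : E, ‖w‖ < 1 → ξ w ≤ (u - ξ x) / r := fun w hw => by
    have := h (x + r • w) (by
      simpa [norm_smul, abs_of_pos hr] using mul_lt_mul_of_pos_left hw hr)
    rw [map_add, map_smul, smul_eq_mul] at this
    rw [le_div_iff₀' hr]
    linarith
  exact hcz.trans_le (abs_le'.2 ⟨hball z hz, by simpa using hball (-z) (by rwa [norm_neg])⟩)

lemma infDist_le_iff_forall_dual_le (hr : 0 ≤ r) :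
    Metric.infDist x K ≤ r ↔ ∀ ξ : StrongDual ℝ E, ξ x ≤ supportFun K ξ + r * ‖ξ‖ := by
  constructor
  · intro h ξ
    obtain ⟨y, hy, hxy⟩ := K.isCompact.exists_infDist_eq_dist K.nonempty x
    calc ξ x = ξ y + ξ (x - y) := by rw [map_sub]; ring
      _ ≤ supportFun K ξ + ‖ξ‖ * ‖x - y‖ :=
        add_le_add (le_supportFun ξ hy) ((le_abs_self _).trans (ξ.le_opNorm _))
      _ ≤ supportFun K ξ + r * ‖ξ‖ := by
        rw [mul_comm, ← dist_eq_norm, ← hxy]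
        gcongr
  · intro h
    by_contra! hlt
    have hpos := hr.trans_lt hlt
    obtain ⟨ξ, u, hball, hK⟩ := geometric_hahn_banach_open (convex_ball x (Metric.infDist x K))
      Metric.isOpen_ball K.convex Metric.disjoint_ball_infDist
    obtain ⟨y, hy, hy'⟩ := exists_mem_eq_supportFun K (-ξ)
    have hnorm := mul_norm_le_of_forall_ball_apply_le hpos fun z hz => (hball z hz).le
    have hξ : 0 < ‖ξ‖ := norm_pos_iff.2 fun h0 => by
      have := (hball x (Metric.mem_ball_self hpos)).trans_le (hK y hy)
      simp [h0] at this
    have hx := h (-ξ)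
    rw [← hy', norm_neg, neg_apply, neg_apply] at hx
    nlinarith [hK y hy, mul_lt_mul_of_pos_right hlt hξ]

lemma mem_iff_forall_dual_le_supportFun : x ∈ K ↔ ∀ ξ : StrongDual ℝ E, ξ x ≤ supportFun K ξ := by
  have h := infDist_le_iff_forall_dual_le (K := K) (x := x) le_rfl
  simp only [zero_mul, add_zero] at h
  rw [← h, Metric.infDist_nonneg.ge_iff_eq', ← K.isClosed.mem_iff_infDist_zero K.nonempty]
  rfl

lemma dist_le_iff_forall_abs_supportFun_sub_le (hr : 0 ≤ r) :
    dist K L ≤ r ↔ ∀ ξ : StrongDual ℝ E, |supportFun K ξ - supportFun L ξ| ≤ r * ‖ξ‖ := by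
  constructor
  · have key : ∀ {K L : ConvexBody E}, dist K L ≤ r → ∀ ξ : StrongDual ℝ E,
        supportFun K ξ - supportFun L ξ ≤ r * ‖ξ‖ := fun {K L} h ξ => by
      obtain ⟨x, hx, hx'⟩ := exists_mem_eq_supportFun K ξ
      have hxL : Metric.infDist x L ≤ r :=
        (Metric.infDist_le_hausdorffDist_of_mem hx ConvexBody.hausdorffEDist_ne_top).trans h
      linarith [(infDist_le_iff_forall_dual_le hr).1 hxL ξ]
    exact fun h ξ => abs_sub_le_iff.2 ⟨key h ξ, key (dist_comm K L ▸ h) ξ⟩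
  · refine fun h => Metric.hausdorffDist_le_of_infDist hr (fun x hx => ?_) fun x hx => ?_
    · exact (infDist_le_iff_forall_dual_le hr).2 fun ξ => by
        linarith [le_supportFun ξ hx, (abs_sub_le_iff.1 (h ξ)).1]
    · exact (infDist_le_iff_forall_dual_le hr).2 fun ξ => by
        linarith [le_supportFun ξ hx, (abs_sub_le_iff.1 (h ξ)).2]

lemma abs_supportFun_sub_le (K L : ConvexBody E) (ξ : StrongDual ℝ E) :
    |supportFun K ξ - supportFun L ξ| ≤ dist K L * ‖ξ‖ :=
  (dist_le_iff_forall_abs_supportFun_sub_le dist_nonneg).1 le_rfl ξ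

lemma continuous_supportFun_left (ξ : StrongDual ℝ E) :
    Continuous fun K : ConvexBody E => supportFun K ξ :=
  (LipschitzWith.of_dist_le_mul (K := ‖ξ‖₊) fun K L => by
    simpa [Real.dist_eq, mul_comm] using abs_supportFun_sub_le K L ξ).continuous

lemma abs_supportFun_le (K : ConvexBody E) (ξ : StrongDual ℝ E) :
    |supportFun K ξ| ≤ dist K 0 * ‖ξ‖ := by
  simpa [supportFun_zero] using abs_supportFun_sub_le K 0 ξ

lemma norm_le_dist_zero (hx : x ∈ K) : ‖x‖ ≤ dist K 0 := by
  have h := Metric.infDist_le_hausdorffDist_of_mem (t := ((0 : ConvexBody E) : Set E)) hx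
    ConvexBody.hausdorffEDist_ne_top
  rwa [ConvexBody.coe_zero, ← Set.singleton_zero, Metric.infDist_singleton, dist_zero_right] at h

lemma continuous_supportFun (K : ConvexBody E) : Continuous (supportFun K) := by
  refine (LipschitzWith.of_le_add_mul (dist K 0).toNNReal fun ξ η => ?_).continuous
  rw [Real.coe_toNNReal _ dist_nonneg, supportFun_le_iff]
  intro x hx
  calc ξ x = η x + (ξ - η) x := by rw [sub_apply]; ring
    _ ≤ supportFun K η + ‖ξ - η‖ * ‖x‖ :=
      add_le_add (le_supportFun η hx) ((le_abs_self _).trans ((ξ - η).le_opNorm x))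
    _ ≤ supportFun K η + dist K 0 * dist ξ η := by
      rw [mul_comm, dist_eq_norm ξ η]
      gcongr
      exact norm_le_dist_zero hx

lemma eq_of_forall_supportFun_eq (h : ∀ ξ, supportFun K ξ = supportFun L ξ) : K = L :=
  dist_le_zero.1 <| (dist_le_iff_forall_abs_supportFun_sub_le le_rfl).2 fun ξ => by simp [h ξ]

lemma dist_convexBody_add_add_le (A B C D : ConvexBody E) :
    dist (A + B) (C + D) ≤ dist A C + dist B D := by
  refine (dist_le_iff_forall_abs_supportFun_sub_le (by positivity)).2 fun ξ => ?_
  rw [supportFun_add, supportFun_add, add_sub_add_comm, add_mul]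
  exact (abs_add_le _ _).trans
    (add_le_add (abs_supportFun_sub_le A C ξ) (abs_supportFun_sub_le B D ξ))

lemma edist_convexBody_add_add_le (A B C D : ConvexBody E) :
    edist (A + B) (C + D) ≤ edist A C + edist B D := by
  simp only [edist_dist, ← ENNReal.ofReal_add dist_nonneg dist_nonneg]
  exact ENNReal.ofReal_le_ofReal (dist_convexBody_add_add_le A B C D)

lemma tendsto_convexBody_add {ι : Type*} {l : Filter ι} {u v : ι → ConvexBody E}
    {A B : ConvexBody E} (hu : Tendsto u l (𝓝 A)) (hv : Tendsto v l (𝓝 B)) :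
    Tendsto (fun i => u i + v i) l (𝓝 (A + B)) := by
  rw [tendsto_iff_dist_tendsto_zero] at hu hv ⊢
  exact squeeze_zero (fun _ => dist_nonneg) (fun i => dist_convexBody_add_add_le _ _ _ _)
    (by simpa using hu.add hv)

lemma measurable_infDist_convexBody [FiniteDimensional ℝ E] [MeasurableSpace E] [BorelSpace E]
    {Ω : Type*} [MeasurableSpace Ω] {Φ : Ω → ConvexBody E}
    (hΦ : ∀ ξ, Measurable fun ω => supportFun (Φ ω) ξ) {w : Ω → E} (hw : Measurable w) :
    Measurable fun ω => Metric.infDist (w ω) (Φ ω) := by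
  refine measurable_of_Iic fun r => ?_
  rcases lt_or_ge r 0 with hr | hr
  · convert MeasurableSet.empty
    exact eq_empty_of_forall_notMem fun ω hω => (hω.trans_lt hr).not_ge Metric.infDist_nonneg
  have hset : (fun ω => Metric.infDist (w ω) (Φ ω)) ⁻¹' Iic r =
      ⋂ n : ℕ, {ω | TopologicalSpace.denseSeq (StrongDual ℝ E) n (w ω) ≤
        supportFun (Φ ω) (TopologicalSpace.denseSeq _ n) +
          r * ‖TopologicalSpace.denseSeq (StrongDual ℝ E) n‖} := by
    ext ω
    simp only [mem_preimage, mem_Iic, infDist_le_iff_forall_dual_le hr, mem_iInter, mem_ofPred_eq]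
    refine ⟨fun h n => h _, fun h ξ => ?_⟩
    refine (TopologicalSpace.denseRange_denseSeq (StrongDual ℝ E)).induction_on
      (p := fun ξ => ξ (w ω) ≤ supportFun (Φ ω) ξ + r * ‖ξ‖) ξ (isClosed_le (by fun_prop) ?_) h
    exact (continuous_supportFun _).add (by fun_prop)
  rw [hset]
  refine MeasurableSet.iInter fun n => measurableSet_le ?_ ((hΦ _).add_const _)
  exact (TopologicalSpace.denseSeq (StrongDual ℝ E) n).continuous.measurable.comp hw

end SupportFunction

section RieszVariation

namespace IntervalPartition

variable {a b : ℝ}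

/-- The partition of `[a, c]` obtained from a partition of `[a, b]` by adding the interval
`[b, c]`. -/
def append (P : IntervalPartition a b) {c : ℝ} (hc : b < c) : IntervalPartition a c where
  n := P.n + 1
  pt i := if i ≤ P.n then P.pt i else c
  pt_zero := by simp [P.pt_zero]
  pt_last := by simp
  pt_lt i hi := by
    rcases Nat.lt_succ_iff_lt_or_eq.1 hi with h | rfl
    · simpa [h.le, Nat.succ_le_of_lt h] using P.pt_lt i h
    · simpa [P.pt_last] using hc

lemma pt_le_pt (P : IntervalPartition a b) {i j : ℕ} (hij : i ≤ j) (hj : j ≤ P.n) :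
    P.pt i ≤ P.pt j := by
  induction j, hij using Nat.le_induction with
  | base => exact le_rfl
  | succ k _ ih => exact (ih (by omega)).trans (P.pt_lt k (by omega)).le

lemma pt_mem (P : IntervalPartition a b) {i : ℕ} (hi : i ≤ P.n) : P.pt i ∈ Icc a b :=
  ⟨P.pt_zero.symm.trans_le (P.pt_le_pt i.zero_le hi),
   (P.pt_le_pt hi le_rfl).trans_eq P.pt_last⟩

lemma exists_mesh_lt (hab : a ≤ b) {δ : ℝ} (hδ : 0 < δ) :
    ∃ P : IntervalPartition a b, ∀ i < P.n, P.pt (i + 1) - P.pt i < δ := by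
  rcases hab.eq_or_lt with rfl | hab
  · exact ⟨⟨0, fun _ => a, rfl, rfl, by simp⟩, by simp⟩
  obtain ⟨n, hn⟩ := exists_nat_gt ((b - a) / δ)
  have hn0 : (0 : ℝ) < n := (div_pos (sub_pos.2 hab) hδ).trans hn
  have hstep : ∀ i : ℕ, a + ↑(i + 1) * ((b - a) / n) - (a + i * ((b - a) / n)) = (b - a) / n := by
    intro i
    push_cast
    ring
  refine ⟨⟨n, fun i => a + i * ((b - a) / n), by simp, by field_simp; ring, fun i _ => ?_⟩,
    fun i _ => ?_⟩
  · rw [← sub_pos, hstep]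
    exact div_pos (sub_pos.2 hab) hn0
  · simp only [hstep]
    rwa [div_lt_comm₀ hn0 hδ]

lemma sum_eq_of_add_eq {G : Type*} [AddCommMonoid G] (P : IntervalPartition a b) {J : ℝ → ℝ → G}
    (h₀ : J a a = 0) (hJ : ∀ x ∈ Icc a b, ∀ y ∈ Icc a b, x ≤ y → J a x + J x y = J a y) :
    ∑ i ∈ Finset.range P.n, J (P.pt i) (P.pt (i + 1)) = J a b := by
  suffices ∀ m ≤ P.n, ∑ i ∈ Finset.range m, J (P.pt i) (P.pt (i + 1)) = J a (P.pt m) by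
    rw [this P.n le_rfl, P.pt_last]
  intro m hm
  induction m with
  | zero => rw [Finset.range_zero, Finset.sum_empty, P.pt_zero, h₀]
  | succ m ih =>
    rw [Finset.sum_range_succ, ih (by omega),
      hJ _ (P.pt_mem (by omega)) _ (P.pt_mem hm) (P.pt_le_pt m.le_succ hm)]

/-- The sum over the intervals of `P` whose supremum over `P` is the Riesz `p`-variation. -/
def rieszSum {M : Type*} [PseudoEMetricSpace M] (p : ℝ) (f : ℝ → M) (P : IntervalPartition a b) :
    ℝ≥0∞ :=
  ∑ i ∈ Finset.range P.n,
    edist (f (P.pt i)) (f (P.pt (i + 1))) ^ p / ENNReal.ofReal ((P.pt (i + 1) - P.pt i) ^ (p - 1))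

end IntervalPartition

section PseudoEMetric

variable {M : Type*} [PseudoEMetricSpace M] {f : ℝ → M} {p T a b c : ℝ}

lemma rieszSum_le_rieszVar (P : IntervalPartition a b) : P.rieszSum p f ≤ rieszVar p f a b :=
  le_iSup (IntervalPartition.rieszSum p f) P

lemma rieszVar_le_iff {W : ℝ≥0∞} :
    rieszVar p f a b ≤ W ↔ ∀ P : IntervalPartition a b, P.rieszSum p f ≤ W :=
  iSup_le_iff

lemma rieszSum_append (P : IntervalPartition a b) (hc : b < c) :
    (P.append hc).rieszSum p f =
      P.rieszSum p f + edist (f b) (f c) ^ p / ENNReal.ofReal ((c - b) ^ (p - 1)) := by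
  simp only [IntervalPartition.rieszSum, IntervalPartition.append]
  rw [Finset.sum_range_succ]
  congr 1
  · refine Finset.sum_congr rfl fun i hi => ?_
    have hi := Finset.mem_range.1 hi
    simp [hi.le, Nat.succ_le_of_lt hi]
  · simp [P.pt_last]

lemma rieszVar_add_le (hab : a ≤ b) (hc : b < c) :
    rieszVar p f a b + edist (f b) (f c) ^ p / ENNReal.ofReal ((c - b) ^ (p - 1)) ≤
      rieszVar p f a c := by
  have : Nonempty (IntervalPartition a b) := ⟨(IntervalPartition.exists_mesh_lt hab one_pos).choose⟩
  rw [rieszVar, ENNReal.iSup_add]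
  exact iSup_le fun P => (rieszSum_append P hc).ge.trans (rieszSum_le_rieszVar _)

lemma rieszVar_mono (hab : a ≤ b) (hbc : b ≤ c) : rieszVar p f a b ≤ rieszVar p f a c := by
  rcases hbc.eq_or_lt with rfl | hbc
  · exact le_rfl
  · exact le_self_add.trans (rieszVar_add_le hab hbc)

lemma MemBV.of_edist_le_add {M₁ M₂ : Type*} [PseudoEMetricSpace M₁] [PseudoEMetricSpace M₂]
    (hp : 1 ≤ p) {f₁ : ℝ → M₁} {f₂ : ℝ → M₂} (h₁ : MemBV p T f₁) (h₂ : MemBV p T f₂)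
    (h : ∀ s t, edist (f s) (f t) ≤ edist (f₁ s) (f₁ t) + edist (f₂ s) (f₂ t)) :
    MemBV p T f := by
  refine lt_of_le_of_lt (b := 2 ^ (p - 1) * (rieszVar p f₁ 0 T + rieszVar p f₂ 0 T)) ?_
    (ENNReal.mul_lt_top (ENNReal.rpow_lt_top_of_nonneg (by linarith) (by simp))
      (ENNReal.add_lt_top.2 ⟨h₁, h₂⟩))
  rw [rieszVar_le_iff]
  intro P
  calc P.rieszSum p f ≤ 2 ^ (p - 1) * (P.rieszSum p f₁ + P.rieszSum p f₂) := by
        simp only [IntervalPartition.rieszSum]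
        rw [← Finset.sum_add_distrib, Finset.mul_sum]
        refine Finset.sum_le_sum fun i _ => ?_
        rw [← ENNReal.add_div, ← mul_div_assoc]
        gcongr
        exact (ENNReal.rpow_le_rpow (h _ _) (by linarith)).trans
          (ENNReal.rpow_add_le_mul_rpow_add_rpow _ _ hp)
    _ ≤ 2 ^ (p - 1) * (rieszVar p f₁ 0 T + rieszVar p f₂ 0 T) := by
        gcongr <;> exact rieszSum_le_rieszVar P

lemma lintegral_rpow_div_le {E : Type*} [NormedAddCommGroup E] (hp : 1 ≤ p) (hab : a < b)
    {φ : ℝ → E} (hφ : AEStronglyMeasurable φ (volume.restrict (Ioc a b))) :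
    (∫⁻ t in Ioc a b, ‖φ t‖ₑ) ^ p / ENNReal.ofReal ((b - a) ^ (p - 1)) ≤
      ∫⁻ t in Ioc a b, ‖φ t‖ₑ ^ p := by
  have hp0 : 0 < p := by linarith
  have hnorm : eLpNorm φ (ENNReal.ofReal p) (volume.restrict (Ioc a b)) ^ p =
      ∫⁻ t in Ioc a b, ‖φ t‖ₑ ^ p := by
    rw [eLpNorm_eq_eLpNorm' (by simpa using hp0) (by simp), ENNReal.toReal_ofReal hp0.le,
      lintegral_rpow_enorm_eq_rpow_eLpNorm' hp0]
  have hholder := eLpNorm_le_eLpNorm_mul_rpow_measure_univ (p := 1) (q := ENNReal.ofReal p)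
    (by simpa using ENNReal.ofReal_le_ofReal hp) hφ
  rw [eLpNorm_one_eq_lintegral_enorm] at hholder
  apply ENNReal.div_le_of_le_mul
  calc (∫⁻ t in Ioc a b, ‖φ t‖ₑ) ^ p
      ≤ (eLpNorm φ (ENNReal.ofReal p) (volume.restrict (Ioc a b)) *
          ENNReal.ofReal (b - a) ^ (1 - 1 / p)) ^ p := by
        refine ENNReal.rpow_le_rpow (hholder.trans_eq ?_) hp0.le
        simp [ENNReal.toReal_ofReal hp0.le]
    _ = (∫⁻ t in Ioc a b, ‖φ t‖ₑ ^ p) * ENNReal.ofReal ((b - a) ^ (p - 1)) := by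
        rw [ENNReal.mul_rpow_of_nonneg _ _ hp0.le, hnorm, ← ENNReal.rpow_mul,
          ← ENNReal.ofReal_rpow_of_pos (sub_pos.2 hab)]
        congr 2
        field_simp

lemma MemBV.of_edist_le_lintegral {E : Type*} [NormedAddCommGroup E] (hp : 1 ≤ p) {φ : ℝ → E}
    (hφ : MemLp φ (ENNReal.ofReal p) (volume.restrict (Icc 0 T)))
    (h : ∀ a ∈ Icc 0 T, ∀ b ∈ Icc 0 T, a ≤ b → edist (f a) (f b) ≤ ∫⁻ t in Ioc a b, ‖φ t‖ₑ) :
    MemBV p T f := by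
  have hp0 : 0 < p := by linarith
  have hfin : ∫⁻ t in Icc 0 T, ‖φ t‖ₑ ^ p < ⊤ := by
    have := lintegral_rpow_enorm_lt_top_of_eLpNorm_lt_top (by simpa using hp0) (by simp) hφ.2
    rwa [ENNReal.toReal_ofReal hp0.le] at this
  refine (rieszVar_le_iff.2 fun P => ?_).trans_lt hfin
  calc P.rieszSum p f
      ≤ ∑ i ∈ Finset.range P.n, ∫⁻ t in Ioc (P.pt i) (P.pt (i + 1)), ‖φ t‖ₑ ^ p := by
        refine Finset.sum_le_sum fun i hi => ?_
        have hi := Finset.mem_range.1 hi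
        have hi₀ := P.pt_mem hi.le
        have hi₁ := P.pt_mem (Nat.succ_le_of_lt hi)
        refine le_trans ?_ (lintegral_rpow_div_le hp (P.pt_lt i hi) (hφ.1.mono_measure
          (Measure.restrict_mono (Ioc_subset_Icc_self.trans (Icc_subset_Icc hi₀.1 hi₁.2)) le_rfl)))
        gcongr
        exact h _ hi₀ _ hi₁ (P.pt_lt i hi).le
    _ = ∫⁻ t in Ioc 0 T, ‖φ t‖ₑ ^ p :=
        P.sum_eq_of_add_eq (J := fun x y => ∫⁻ t in Ioc x y, ‖φ t‖ₑ ^ p) (by simp)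
          fun x hx y _ hxy => by
            rw [← lintegral_union measurableSet_Ioc (Ioc_disjoint_Ioc_of_le le_rfl),
              Ioc_union_Ioc_eq_Ioc hx.1 hxy]
    _ ≤ ∫⁻ t in Icc 0 T, ‖φ t‖ₑ ^ p := lintegral_mono_set Ioc_subset_Icc_self

end PseudoEMetric

section AbsoluteContinuity

variable {M : Type*} [PseudoMetricSpace M] {f : ℝ → M} {p T : ℝ}

lemma MemBV.exists_monotoneOn_rpow_dist_le (hp : 1 < p) (hf : MemBV p T f) :
    ∃ V : ℝ → ℝ, MonotoneOn V (Icc 0 T) ∧ ∀ a ∈ Icc 0 T, ∀ b ∈ Icc 0 T,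
      dist (f a) (f b) ^ p ≤ dist (V a) (V b) * dist a b ^ (p - 1) := by
  have hfin : ∀ t ∈ Icc 0 T, rieszVar p f 0 t ≠ ⊤ := fun t ht =>
    ((rieszVar_mono ht.1 ht.2).trans_lt hf).ne
  have hmono : MonotoneOn (fun t => (rieszVar p f 0 t).toReal) (Icc 0 T) := fun a ha b hb hab =>
    ENNReal.toReal_mono (hfin b hb) (rieszVar_mono ha.1 hab)
  refine ⟨fun t => (rieszVar p f 0 t).toReal, hmono, fun a ha b hb => ?_⟩
  wlog hab : a < b generalizing a b
  · rcases (not_lt.1 hab).eq_or_lt with rfl | hba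
    · simp [Real.zero_rpow (by linarith : p ≠ 0)]
    · simpa only [dist_comm] using this b hb a ha hba
  have hpos : 0 < (b - a) ^ (p - 1) := Real.rpow_pos_of_pos (sub_pos.2 hab) _
  have h : rieszVar p f 0 a + edist (f a) (f b) ^ p / ENNReal.ofReal ((b - a) ^ (p - 1)) ≤
      rieszVar p f 0 b := rieszVar_add_le ha.1 hab
  have h' := ENNReal.toReal_mono (hfin b hb) h
  rw [ENNReal.toReal_add (hfin a ha) (ne_top_of_le_ne_top (hfin b hb) (le_add_self.trans h)),
    ENNReal.toReal_div, ← ENNReal.toReal_rpow, ENNReal.toReal_ofReal hpos.le, edist_dist,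
    ENNReal.toReal_ofReal dist_nonneg] at h'
  rw [dist_comm (rieszVar p f 0 a).toReal, dist_comm a, Real.dist_eq, Real.dist_eq,
    abs_of_pos (sub_pos.2 hab), abs_of_nonneg (sub_nonneg.2 (hmono ha hb hab.le)),
    ← div_le_iff₀ hpos]
  linarith

lemma le_mul_add_div_of_rpow_le (hp : 1 < p) {C x l v : ℝ} (hC : 0 < C) (hl : 0 ≤ l)
    (hv : 0 ≤ v) (h : x ^ p ≤ v * l ^ (p - 1)) : x ≤ C * l + v / C ^ (p - 1) := by
  have hp1 : 0 < p - 1 := sub_pos.2 hp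
  by_cases hxl : x ≤ C * l
  · exact hxl.trans (le_add_of_nonneg_right (by positivity))
  push Not at hxl
  have hx : 0 < x := (mul_nonneg hC.le hl).trans_lt hxl
  have hxp : x ^ (p - 1) * x = x ^ p := by rw [← Real.rpow_add_one hx.ne', sub_add_cancel]
  have hl' : 0 < l := hl.lt_of_ne' fun h0 => by
    rw [h0, Real.zero_rpow hp1.ne', mul_zero] at h
    exact (Real.rpow_pos_of_pos hx p).not_ge h
  suffices x * C ^ (p - 1) ≤ v by
    rw [← le_div_iff₀ (by positivity)] at this
    exact this.trans (le_add_of_nonneg_left (by positivity))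
  refine le_of_mul_le_mul_right ?_ (Real.rpow_pos_of_pos hl' (p - 1))
  calc x * C ^ (p - 1) * l ^ (p - 1) = (C * l) ^ (p - 1) * x := by
        rw [Real.mul_rpow hC.le hl]
        ring
    _ ≤ x ^ (p - 1) * x := by gcongr
    _ ≤ v * l ^ (p - 1) := hxp.trans_le h

lemma sum_dist_le_of_monotoneOn {V : ℝ → ℝ} {x y : ℝ} (hV : MonotoneOn V (uIcc x y)) {ι : Type*}
    {s : Finset ι} {I : ι → ℝ × ℝ} (hI : ∀ i ∈ s, (I i).1 ∈ uIcc x y ∧ (I i).2 ∈ uIcc x y)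
    (hdisj : (s : Set ι).PairwiseDisjoint fun i => uIoc (I i).1 (I i).2) :
    ∑ i ∈ s, dist (V (I i).1) (V (I i).2) ≤ dist (V x) (V y) := by
  have hsub : ∀ i ∈ s, uIoc (V (I i).1) (V (I i).2) ⊆ uIoc (V x) (V y) := fun i hi =>
    uIoc_subset_uIoc_of_uIcc_subset_uIcc
      (uIcc_subset_uIcc (hV.mapsTo_uIcc (hI i hi).1) (hV.mapsTo_uIcc (hI i hi).2))
  have hmin : ∀ i ∈ s, min (I i).1 (I i).2 ∈ uIcc x y := fun i hi =>
    min_rec' (· ∈ uIcc x y) (hI i hi).1 (hI i hi).2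
  have hmax : ∀ i ∈ s, max (I i).1 (I i).2 ∈ uIcc x y := fun i hi =>
    max_rec' (· ∈ uIcc x y) (hI i hi).1 (hI i hi).2
  have hdisjV : (s : Set ι).PairwiseDisjoint fun i => uIoc (V (I i).1) (V (I i).2) := by
    intro i hi j hj hij
    have h := hdisj hi hj hij
    simp only [Function.onFun, uIoc, Ioc_disjoint_Ioc] at h ⊢
    rw [← hV.map_max (hI i hi).1 (hI i hi).2, ← hV.map_max (hI j hj).1 (hI j hj).2,
      ← hV.map_min (hI i hi).1 (hI i hi).2, ← hV.map_min (hI j hj).1 (hI j hj).2]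
    rw [← hV.map_min (hmax i hi) (hmax j hj), ← hV.map_max (hmin i hi) (hmin j hj)]
    exact hV (min_rec' (· ∈ uIcc x y) (hmax i hi) (hmax j hj))
      (max_rec' (· ∈ uIcc x y) (hmin i hi) (hmin j hj)) h
  have hvol : ∀ u v : ℝ, volume (uIoc u v) = ENNReal.ofReal (dist u v) := fun u v => by
    rw [uIoc, Real.volume_Ioc, max_sub_min_eq_abs', Real.dist_eq]
  rw [← ENNReal.ofReal_le_ofReal_iff dist_nonneg,
    ENNReal.ofReal_sum_of_nonneg fun _ _ => dist_nonneg]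
  simp only [← hvol]
  rw [← measure_biUnion_finset hdisjV fun _ _ => measurableSet_uIoc]
  exact measure_mono (iUnion₂_subset hsub)

lemma MemBV.absolutelyContinuousOnInterval (hp : 1 < p) (hT : 0 ≤ T) (hf : MemBV p T f) :
    AbsolutelyContinuousOnInterval f 0 T := by
  obtain ⟨V, hV, hVf⟩ := hf.exists_monotoneOn_rpow_dist_le hp
  rw [← uIcc_of_le hT] at hV hVf
  rw [absolutelyContinuousOnInterval_iff]
  intro ε hε
  obtain ⟨C, hCε, hC⟩ : ∃ C : ℝ, dist (V 0) (V T) / C ^ (p - 1) < ε / 2 ∧ 0 < C :=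
    (((tendsto_const_nhds.div_atTop (tendsto_rpow_atTop (sub_pos.2 hp))).eventually_lt_const
      (half_pos hε)).and (eventually_gt_atTop 0)).exists
  refine ⟨ε / (2 * C), by positivity, ?_⟩
  rintro ⟨n, I⟩ ⟨hI, hdisj⟩ hlen
  calc ∑ i ∈ Finset.range n, dist (f (I i).1) (f (I i).2)
      ≤ ∑ i ∈ Finset.range n,
          (C * dist (I i).1 (I i).2 + dist (V (I i).1) (V (I i).2) / C ^ (p - 1)) :=
        Finset.sum_le_sum fun i hi => le_mul_add_div_of_rpow_le hp hC dist_nonneg dist_nonneg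
          (hVf _ (hI i hi).1 _ (hI i hi).2)
    _ = C * ∑ i ∈ Finset.range n, dist (I i).1 (I i).2 +
          (∑ i ∈ Finset.range n, dist (V (I i).1) (V (I i).2)) / C ^ (p - 1) := by
        rw [Finset.sum_add_distrib, Finset.mul_sum, Finset.sum_div]
    _ ≤ C * ∑ i ∈ Finset.range n, dist (I i).1 (I i).2 + dist (V 0) (V T) / C ^ (p - 1) := by
        gcongr
        exact sum_dist_le_of_monotoneOn hV hI hdisj
    _ < C * (ε / (2 * C)) + ε / 2 := by gcongr
    _ = ε := by field_simp; ring

end AbsoluteContinuity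

end RieszVariation

section FundamentalTheorem

variable {E : Type*} [NormedAddCommGroup E] [NormedSpace ℝ E] {p T : ℝ}

lemma absolutelyContinuousOnInterval_comp_of_lipschitzWith {M N : Type*} [PseudoMetricSpace M]
    [PseudoMetricSpace N] {u : M → N} {K : ℝ≥0} (hu : LipschitzWith K u) {f : ℝ → M} {a b : ℝ}
    (hf : AbsolutelyContinuousOnInterval f a b) :
    AbsolutelyContinuousOnInterval (u ∘ f) a b := by
  have hK := Filter.Tendsto.const_mul (K : ℝ) hf
  rw [mul_zero] at hK
  refine squeeze_zero (fun _ => Finset.sum_nonneg fun _ _ => dist_nonneg) (fun I => ?_) hK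
  rw [Finset.mul_sum]
  exact Finset.sum_le_sum fun i _ => hu.dist_le_mul _ _

lemma integral_deriv_eq_sub_of_absolutelyContinuousOnInterval [FiniteDimensional ℝ E] {f : ℝ → E}
    {a b : ℝ} (hf : AbsolutelyContinuousOnInterval f a b)
    (hf' : IntervalIntegrable (deriv f) volume a b) : ∫ t in a..b, deriv f t = f b - f a := by
  refine (SeparatingDual.eq_iff_forall_dual_eq (R := ℝ)).2 fun ξ => ?_
  have hderiv : ∀ᵐ t, t ∈ uIoc a b → ξ (deriv f t) = deriv (ξ ∘ f) t := by
    filter_upwards [hf.boundedVariationOn.ae_differentiableAt_of_mem_uIcc] with t ht hab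
    exact (ξ.hasFDerivAt.comp_hasDerivAt t (ht (uIoc_subset_uIcc hab)).hasDerivAt).deriv.symm
  rw [← ξ.intervalIntegral_comp_comm hf', intervalIntegral.integral_congr_ae hderiv,
    (absolutelyContinuousOnInterval_comp_of_lipschitzWith ξ.lipschitz hf).integral_deriv_eq_sub,
    map_sub, Function.comp_apply, Function.comp_apply]

lemma intervalIntegrable_of_memLp {F : Type*} [NormedAddCommGroup F] (hp : 1 ≤ p) {φ : ℝ → F}
    (hφ : MemLp φ (ENNReal.ofReal p) (volume.restrict (Icc 0 T))) {a b : ℝ}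
    (ha : a ∈ Icc 0 T) (hb : b ∈ Icc 0 T) : IntervalIntegrable φ volume a b :=
  intervalIntegrable_iff.2 <| IntegrableOn.mono_set
    (hφ.integrable (by simpa using ENNReal.ofReal_le_ofReal hp))
    (uIoc_subset_uIcc.trans (uIcc_subset_Icc ha hb))

lemma MemBV.ae_differentiableAt [FiniteDimensional ℝ E] (hp : 1 < p) (hT : 0 ≤ T) {f : ℝ → E}
    (hf : MemBV p T f) : ∀ᵐ t ∂(volume.restrict (Icc 0 T)), DifferentiableAt ℝ f t := by
  have := (hf.absolutelyContinuousOnInterval hp hT).boundedVariationOn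
  rw [ae_restrict_iff' measurableSet_Icc, ← uIcc_of_le hT]
  exact this.ae_differentiableAt_of_mem_uIcc

lemma MemBV.integral_deriv_eq_sub [FiniteDimensional ℝ E] (hp : 1 < p) {f : ℝ → E}
    (hf : MemBV p T f) (hf' : MemLp (deriv f) (ENNReal.ofReal p) (volume.restrict (Icc 0 T)))
    {a b : ℝ} (ha : a ∈ Icc 0 T) (hb : b ∈ Icc 0 T) : ∫ t in a..b, deriv f t = f b - f a := by
  have hT : 0 ≤ T := ha.1.trans ha.2
  have hsub : uIcc a b ⊆ uIcc 0 T := uIcc_of_le hT ▸ uIcc_subset_Icc ha hb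
  exact integral_deriv_eq_sub_of_absolutelyContinuousOnInterval
    ((hf.absolutelyContinuousOnInterval hp hT).mono hsub)
    (intervalIntegrable_of_memLp hp.le hf' ha hb)

lemma MemBV.add_integral (hp : 1 ≤ p) {φ : ℝ → E}
    (hφ : MemLp φ (ENNReal.ofReal p) (volume.restrict (Icc 0 T))) (x : E) :
    MemBV p T fun t => x + ∫ u in (0 : ℝ)..t, φ u := by
  refine MemBV.of_edist_le_lintegral hp hφ fun a ha b hb hab => ?_
  have h₀ : (0 : ℝ) ∈ Icc 0 T := ⟨le_rfl, ha.1.trans ha.2⟩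
  rw [edist_comm, edist_eq_enorm_sub, add_sub_add_left_eq_sub,
    intervalIntegral.integral_interval_sub_left (intervalIntegrable_of_memLp hp hφ h₀ hb)
      (intervalIntegrable_of_memLp hp hφ h₀ ha), intervalIntegral.integral_of_le hab]
  exact enorm_integral_le_lintegral_enorm _

end FundamentalTheorem

section MeasurableSelection

variable {Ω E : Type*} [MeasurableSpace Ω]

/-- Weak measurability of a multifunction `Γ`: the set of `ω` at which `Γ ω` meets a given open set
is measurable. This is the notion of measurability in the Kuratowski–Ryll-Nardzewski selection
theorem. -/
def WeaklyMeasurable [TopologicalSpace E] (Γ : Ω → Set E) : Prop :=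
  ∀ U, IsOpen U → MeasurableSet {ω | (Γ ω ∩ U).Nonempty}

lemma WeaklyMeasurable.inter_of_measurable [TopologicalSpace E] {Γ : Ω → Set E}
    (hΓ : WeaklyMeasurable Γ) {V : ℕ → Set E} (hV : ∀ n, IsOpen (V n)) {κ : Ω → ℕ}
    (hκ : Measurable κ) : WeaklyMeasurable fun ω => Γ ω ∩ V (κ ω) := by
  intro U hU
  have hset : {ω | (Γ ω ∩ V (κ ω) ∩ U).Nonempty} =
      ⋃ n, κ ⁻¹' {n} ∩ {ω | (Γ ω ∩ (V n ∩ U)).Nonempty} := by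
    ext ω
    simp [inter_assoc]
  rw [hset]
  exact MeasurableSet.iUnion fun n =>
    (hκ (measurableSet_singleton n)).inter (hΓ _ ((hV n).inter hU))

lemma WeaklyMeasurable.exists_measurable_inter_nonempty [TopologicalSpace E] {Γ : Ω → Set E}
    (hΓ : WeaklyMeasurable Γ) (hne : ∀ ω, (Γ ω).Nonempty) {V : ℕ → Set E}
    (hV : ∀ n, IsOpen (V n)) (hcover : ⋃ n, V n = univ) :
    ∃ κ : Ω → ℕ, Measurable κ ∧ ∀ ω, (Γ ω ∩ V (κ ω)).Nonempty := by
  classical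
  have hex : ∀ ω, ∃ n, (Γ ω ∩ V n).Nonempty := fun ω => by
    obtain ⟨x, hx⟩ := hne ω
    obtain ⟨n, hn⟩ := mem_iUnion.1 (hcover ▸ mem_univ x)
    exact ⟨n, x, hx, hn⟩
  exact ⟨fun ω => Nat.find (hex ω), measurable_find hex fun n => hΓ _ (hV n),
    fun ω => Nat.find_spec (hex ω)⟩

lemma WeaklyMeasurable.exists_measurable_ball_inter_nonempty [PseudoMetricSpace E]
    [TopologicalSpace.SeparableSpace E] [Nonempty E] {Γ : Ω → Set E} (hΓ : WeaklyMeasurable Γ)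
    (hne : ∀ ω, (Γ ω).Nonempty) {ε : ℝ} (hε : 0 < ε) :
    ∃ κ : Ω → ℕ, Measurable κ ∧
      WeaklyMeasurable (fun ω => Γ ω ∩ Metric.ball (TopologicalSpace.denseSeq E (κ ω)) ε) ∧
      ∀ ω, (Γ ω ∩ Metric.ball (TopologicalSpace.denseSeq E (κ ω)) ε).Nonempty := by
  let V n := Metric.ball (TopologicalSpace.denseSeq E n) ε
  have hV : ∀ n, IsOpen (V n) := fun n => Metric.isOpen_ball
  have hcover : ⋃ n, V n = univ := eq_univ_of_forall fun x => by
    obtain ⟨n, hn⟩ := (TopologicalSpace.denseRange_denseSeq E).exists_dist_lt x hε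
    exact mem_iUnion.2 ⟨n, hn⟩
  obtain ⟨κ, hκ, hκΓ⟩ := hΓ.exists_measurable_inter_nonempty hne hV hcover
  exact ⟨κ, hκ, hΓ.inter_of_measurable hV hκ, hκΓ⟩

lemma WeaklyMeasurable.exists_seq_inter_ball [PseudoMetricSpace E]
    [TopologicalSpace.SeparableSpace E] [Nonempty E] {Γ : Ω → Set E} (hΓ : WeaklyMeasurable Γ)
    (hne : ∀ ω, (Γ ω).Nonempty) {ε : ℕ → ℝ} (hε : ∀ n, 0 < ε n) :
    ∃ (Δ : ℕ → Ω → Set E) (κ : ℕ → Ω → ℕ), Δ 0 = Γ ∧ (∀ n, Measurable (κ n)) ∧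
      (∀ n ω, (Δ n ω).Nonempty) ∧
      ∀ n ω, Δ (n + 1) ω = Δ n ω ∩ Metric.ball (TopologicalSpace.denseSeq E (κ n ω)) (ε n) := by
  let S := {Δ : Ω → Set E // WeaklyMeasurable Δ ∧ ∀ ω, (Δ ω).Nonempty}
  choose κ hκ hw hn using fun (n : ℕ) (Δ : S) =>
    Δ.2.1.exists_measurable_ball_inter_nonempty Δ.2.2 (hε n)
  let Δ : ℕ → S := fun n => Nat.rec ⟨Γ, hΓ, hne⟩ (fun n Δ => ⟨_, hw n Δ, hn n Δ⟩) n
  exact ⟨fun n => (Δ n).1, fun n => κ n (Δ n), rfl, fun n => hκ n (Δ n), fun n => (Δ n).2.2,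
    fun n ω => rfl⟩

theorem WeaklyMeasurable.exists_measurable_mem [PseudoMetricSpace E]
    [TopologicalSpace.SeparableSpace E] [CompleteSpace E] [MeasurableSpace E] [BorelSpace E]
    {Γ : Ω → Set E} (hΓ : WeaklyMeasurable Γ) (hne : ∀ ω, (Γ ω).Nonempty)
    (hcl : ∀ ω, IsClosed (Γ ω)) : ∃ φ : Ω → E, Measurable φ ∧ ∀ ω, φ ω ∈ Γ ω := by
  rcases isEmpty_or_nonempty Ω with hΩ | ⟨⟨ω₀⟩⟩
  · exact ⟨fun ω => hΩ.elim ω, measurable_of_empty _, fun ω => hΩ.elim ω⟩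
  have : Nonempty E := (hne ω₀).to_type
  obtain ⟨Δ, κ, hΔ₀, hκ, hΔne, hΔ⟩ := hΓ.exists_seq_inter_ball hne (ε := fun n => (1 / 2 : ℝ) ^ n)
    fun n => by positivity
  let ψ : ℕ → Ω → E := fun n ω => TopologicalSpace.denseSeq E (κ n ω)
  have hψ : ∀ n, Measurable (ψ n) := fun n => measurable_from_nat.comp (hκ n)
  have hsub : ∀ n ω, Δ n ω ⊆ Γ ω := fun n ω => by
    induction n with
    | zero => rw [hΔ₀]
    | succ n ih => exact (hΔ n ω ▸ inter_subset_left).trans ih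
  have hnear : ∀ n ω, ∃ x ∈ Γ ω, dist x (ψ n ω) < (1 / 2) ^ n := fun n ω => by
    obtain ⟨x, hx⟩ := hΔne (n + 1) ω
    exact ⟨x, hsub _ ω hx, (hΔ n ω ▸ hx).2⟩
  have hdist : ∀ ω n, dist (ψ n ω) (ψ (n + 1) ω) ≤ 2 * (1 / 2) ^ n := fun ω n => by
    obtain ⟨x, hx⟩ := hΔne (n + 2) ω
    rw [hΔ (n + 1), hΔ n] at hx
    have h₁ : dist x (ψ n ω) < (1 / 2) ^ n := hx.1.2
    have h₂ : dist x (ψ (n + 1) ω) < (1 / 2) ^ (n + 1) := hx.2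
    have h₃ : (1 / 2 : ℝ) ^ (n + 1) ≤ (1 / 2) ^ n :=
      pow_le_pow_of_le_one (by norm_num) (by norm_num) n.le_succ
    linarith [dist_triangle_left (ψ n ω) (ψ (n + 1) ω) x]
  choose φ hφ using fun ω =>
    cauchySeq_tendsto_of_complete (cauchySeq_of_le_geometric _ _ one_half_lt_one (hdist ω))
  refine ⟨φ, measurable_of_tendsto_metrizable hψ (tendsto_pi_nhds.2 hφ), fun ω => ?_⟩
  choose x hx hxψ using fun n => hnear n ω
  refine (hcl ω).mem_of_tendsto (f := x) (b := atTop) ?_ (Eventually.of_forall hx)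
  refine (tendsto_iff_of_dist ?_).2 (hφ ω)
  exact squeeze_zero (fun _ => dist_nonneg) (fun n => (hxψ n).le)
    (tendsto_pow_atTop_nhds_zero_of_lt_one (by norm_num) (by norm_num))

variable [PseudoMetricSpace E]

lemma measurableSet_exists_le_zero_of_isCompact {c : Ω → E → ℝ}
    (hc : ∀ x, Measurable fun ω => c ω x)
    (hcont : ∀ ω, Continuous (c ω)) {K : Set E} (hK : IsCompact K) :
    MeasurableSet {ω | ∃ x ∈ K, c ω x ≤ 0} := by
  obtain ⟨D, hDK, hD, hKD⟩ := hK.isSeparable.exists_countable_dense_subset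
  have hset : {ω | ∃ x ∈ K, c ω x ≤ 0} = ⋂ n : ℕ, ⋃ q ∈ D, {ω | c ω q < 1 / (n + 1)} := by
    ext ω
    simp only [mem_ofPred_eq, mem_iInter, mem_iUnion, exists_prop]
    refine ⟨fun ⟨x, hx, hcx⟩ n => ?_, fun h => ?_⟩
    · obtain ⟨q, hq, hqD⟩ := mem_closure_iff.1 (hKD hx) _ (isOpen_lt (hcont ω) continuous_const)
        (hcx.trans_lt (Nat.one_div_pos_of_nat (n := n)))
      exact ⟨q, hqD, hq⟩
    · choose q hqD hq using h
      obtain ⟨x, hx, hmin⟩ := hK.exists_isMinOn ⟨_, hDK (hqD 0)⟩ (hcont ω).continuousOn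
      exact ⟨x, hx, ge_of_tendsto' tendsto_one_div_add_atTop_nhds_zero_nat fun n =>
        (hmin (hDK (hqD n))).trans (hq n).le⟩
  rw [hset]
  exact MeasurableSet.iInter fun n => MeasurableSet.biUnion hD fun q _ =>
    measurableSet_lt (hc q) measurable_const

lemma weaklyMeasurable_le_zero [ProperSpace E] {c : Ω → E → ℝ}
    (hc : ∀ x, Measurable fun ω => c ω x) (hcont : ∀ ω, Continuous (c ω)) :
    WeaklyMeasurable fun ω => {x | c ω x ≤ 0} := by
  intro U hU
  have := hU.locallyCompactSpace
  have hUσ : IsSigmaCompact U := isSigmaCompact_iff_sigmaCompactSpace.2 inferInstance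
  obtain ⟨K, hK, hKU⟩ := hUσ
  have hset : {ω | ({x | c ω x ≤ 0} ∩ U).Nonempty} = ⋃ n, {ω | ∃ x ∈ K n, c ω x ≤ 0} := by
    ext ω
    simp only [← hKU, Set.Nonempty, mem_inter_iff, mem_ofPred_eq, mem_iUnion]
    grind
  rw [hset]
  exact MeasurableSet.iUnion fun n => measurableSet_exists_le_zero_of_isCompact hc hcont (hK n)

end MeasurableSelection

section SelectionOfSum

variable {Ω E : Type*} [MeasurableSpace Ω] [NormedAddCommGroup E] [NormedSpace ℝ E]
  [FiniteDimensional ℝ E] [MeasurableSpace E] [BorelSpace E]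

lemma exists_measurable_mem_sub_mem {A B : Ω → ConvexBody E}
    (hA : ∀ ξ, Measurable fun ω => supportFun (A ω) ξ)
    (hB : ∀ ξ, Measurable fun ω => supportFun (B ω) ξ) {v : Ω → E} (hv : Measurable v)
    (hmem : ∀ ω, v ω ∈ A ω + B ω) :
    ∃ φ : Ω → E, Measurable φ ∧ ∀ ω, φ ω ∈ A ω ∧ v ω - φ ω ∈ B ω := by
  let c : Ω → E → ℝ := fun ω x => Metric.infDist x (A ω) + Metric.infDist (v ω - x) (B ω)
  have hc : ∀ x, Measurable fun ω => c ω x := fun x =>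
    (measurable_infDist_convexBody hA measurable_const).add
      (measurable_infDist_convexBody hB (hv.sub_const x))
  have hcont : ∀ ω, Continuous (c ω) := fun ω =>
    (Metric.continuous_infDist_pt _).add ((Metric.continuous_infDist_pt _).comp (by fun_prop))
  have mem_iff : ∀ (K : ConvexBody E) x, Metric.infDist x K = 0 ↔ x ∈ K := fun K x =>
    (K.isClosed.mem_iff_infDist_zero K.nonempty).symm
  have hc_le : ∀ ω x, c ω x ≤ 0 ↔ x ∈ A ω ∧ v ω - x ∈ B ω := fun ω x => by
    rw [← mem_iff, ← mem_iff, ← add_eq_zero_iff_of_nonneg Metric.infDist_nonneg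
      Metric.infDist_nonneg, le_antisymm_iff, and_iff_left]
    exact add_nonneg Metric.infDist_nonneg Metric.infDist_nonneg
  have := FiniteDimensional.proper ℝ E
  obtain ⟨φ, hφ, hφc⟩ := (weaklyMeasurable_le_zero hc hcont).exists_measurable_mem
    (fun ω => by
      obtain ⟨a, ha, b, hb, hab⟩ := hmem ω
      exact ⟨a, (hc_le ω a).2 ⟨ha, by rwa [← hab, add_sub_cancel_left]⟩⟩)
    (fun ω => isClosed_le (hcont ω) continuous_const)
  exact ⟨φ, hφ, fun ω => (hc_le ω _).1 (hφc ω)⟩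

end SelectionOfSum

section YoungIntegral

variable {E : Type*} [NormedAddCommGroup E] [NormedSpace ℝ E] {f φ : ℝ → E} {g : ℝ → ℝ}
  {a b c s t η : ℝ}

lemma HasYoungIntegral.unique (hst : s ≤ t) {I J : E} (hI : HasYoungIntegral f g s t I)
    (hJ : HasYoungIntegral f g s t J) : I = J := by
  refine eq_of_forall_dist_le fun ε hε => ?_
  obtain ⟨δ₁, hδ₁, h₁⟩ := hI (ε / 2) (half_pos hε)
  obtain ⟨δ₂, hδ₂, h₂⟩ := hJ (ε / 2) (half_pos hε)
  obtain ⟨P, hP⟩ := IntervalPartition.exists_mesh_lt hst (lt_min hδ₁ hδ₂)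
  have h₁ := h₁ P fun i hi => (hP i hi).trans_le (min_le_left _ _)
  have h₂ := h₂ P fun i hi => (hP i hi).trans_le (min_le_right _ _)
  rw [← dist_eq_norm] at h₁ h₂
  exact (dist_triangle_left _ _ _).trans (by linarith)

lemma HasYoungIntegral.congr {f' : ℝ → E} {I : E} (hI : HasYoungIntegral f g s t I)
    (hf : EqOn f f' (Icc s t)) : HasYoungIntegral f' g s t I := by
  intro ε hε
  obtain ⟨δ, hδ, h⟩ := hI ε hε
  refine ⟨δ, hδ, fun P hP => ?_⟩
  have hsum : ∑ i ∈ Finset.range P.n, (g (P.pt (i + 1)) - g (P.pt i)) • f (P.pt i) =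
      ∑ i ∈ Finset.range P.n, (g (P.pt (i + 1)) - g (P.pt i)) • f' (P.pt i) :=
    Finset.sum_congr rfl fun i hi => by rw [hf (P.pt_mem (Finset.mem_range.1 hi).le)]
  exact hsum ▸ h P hP

lemma HasYoungIntegral.add {f₁ f₂ : ℝ → E} {I₁ I₂ : E} (h₁ : HasYoungIntegral f₁ g s t I₁)
    (h₂ : HasYoungIntegral f₂ g s t I₂) : HasYoungIntegral (f₁ + f₂) g s t (I₁ + I₂) := by
  intro ε hε
  obtain ⟨δ₁, hδ₁, h₁⟩ := h₁ (ε / 2) (half_pos hε)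
  obtain ⟨δ₂, hδ₂, h₂⟩ := h₂ (ε / 2) (half_pos hε)
  refine ⟨min δ₁ δ₂, lt_min hδ₁ hδ₂, fun P hP => ?_⟩
  have h₁ := h₁ P fun i hi => (hP i hi).trans_le (min_le_left _ _)
  have h₂ := h₂ P fun i hi => (hP i hi).trans_le (min_le_right _ _)
  simp only [Pi.add_apply, smul_add, Finset.sum_add_distrib, add_sub_add_comm]
  exact (norm_add_le _ _).trans_lt (by linarith)

/-- The right-hand side of the integration by parts formula for `∫_s^t f dg`, where `φ` stands for
the derivative of `f`. -/
def partsIntegral (f φ : ℝ → E) (g : ℝ → ℝ) (s t : ℝ) : E :=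
  g t • f t - g s • f s - ∫ u in s..t, g u • φ u

lemma partsIntegral_add_partsIntegral
    (hab : IntervalIntegrable (fun u => g u • φ u) volume a b)
    (hbc : IntervalIntegrable (fun u => g u • φ u) volume b c) :
    partsIntegral f φ g a b + partsIntegral f φ g b c = partsIntegral f φ g a c := by
  simp only [partsIntegral, ← intervalIntegral.integral_add_adjacent_intervals hab hbc]
  abel

lemma smul_sub_partsIntegral (hφ : IntervalIntegrable φ volume a b)
    (hf : ∫ u in a..b, φ u = f b - f a) (hg : ContinuousOn g (uIcc a b)) :
    (g b - g a) • f a - partsIntegral f φ g a b = ∫ u in a..b, (g u - g b) • φ u := by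
  simp only [sub_smul]
  rw [intervalIntegral.integral_sub (hφ.continuousOn_smul hg)
      (hφ.continuousOn_smul continuousOn_const),
    intervalIntegral.integral_smul, hf, smul_sub, partsIntegral]
  abel

lemma norm_smul_sub_partsIntegral_le (hab : a ≤ b) (hφ : IntervalIntegrable φ volume a b)
    (hf : ∫ u in a..b, φ u = f b - f a) (hg : ContinuousOn g (Icc a b))
    (hη : ∀ u ∈ Icc a b, dist (g u) (g b) ≤ η) :
    ‖(g b - g a) • f a - partsIntegral f φ g a b‖ ≤ η * ∫ u in a..b, ‖φ u‖ := by
  rw [smul_sub_partsIntegral hφ hf (uIcc_of_le hab ▸ hg), ← intervalIntegral.integral_const_mul]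
  refine intervalIntegral.norm_integral_le_of_norm_le hab
    (Eventually.of_forall fun u hu => ?_) (hφ.norm.const_mul η)
  rw [norm_smul, ← dist_eq_norm]
  exact mul_le_mul_of_nonneg_right (hη u (Ioc_subset_Icc_self hu)) (norm_nonneg _)

lemma norm_partsIntegral_le (hab : a ≤ b) (hφ : IntervalIntegrable φ volume a b)
    (hf : ∫ u in a..b, φ u = f b - f a) (hg : ContinuousOn g (Icc a b))
    (hη : ∀ u ∈ Icc a b, dist (g u) (g b) ≤ η) :
    ‖partsIntegral f φ g a b‖ ≤ η * (‖f a‖ + ∫ u in a..b, ‖φ u‖) := by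
  have hsmul : ‖(g b - g a) • f a‖ ≤ η * ‖f a‖ := by
    rw [norm_smul, ← dist_eq_norm, dist_comm]
    exact mul_le_mul_of_nonneg_right (hη a ⟨le_rfl, hab⟩) (norm_nonneg _)
  calc ‖partsIntegral f φ g a b‖
      = ‖(g b - g a) • f a - ((g b - g a) • f a - partsIntegral f φ g a b)‖ := by
        rw [sub_sub_cancel]
    _ ≤ η * ‖f a‖ + η * ∫ u in a..b, ‖φ u‖ := (norm_sub_le _ _).trans
        (add_le_add hsmul (norm_smul_sub_partsIntegral_le hab hφ hf hg hη))
    _ = η * (‖f a‖ + ∫ u in a..b, ‖φ u‖) := (mul_add _ _ _).symm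

lemma norm_sum_sub_partsIntegral_le (hφ : IntervalIntegrable φ volume s t)
    (hf : ∀ a ∈ Icc s t, ∀ b ∈ Icc s t, ∫ u in a..b, φ u = f b - f a)
    (hg : ContinuousOn g (Icc s t)) (P : IntervalPartition s t)
    (hη : ∀ i < P.n, ∀ u ∈ Icc (P.pt i) (P.pt (i + 1)), dist (g u) (g (P.pt (i + 1))) ≤ η) :
    ‖∑ i ∈ Finset.range P.n, (g (P.pt (i + 1)) - g (P.pt i)) • f (P.pt i) -
      partsIntegral f φ g s t‖ ≤ η * ∫ u in s..t, ‖φ u‖ := by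
  have hst : s ≤ t := by simpa only [P.pt_zero, P.pt_last] using P.pt_le_pt P.n.zero_le le_rfl
  have hsub : ∀ {x y}, x ∈ Icc s t → y ∈ Icc s t → uIcc x y ⊆ uIcc s t := fun hx hy =>
    uIcc_of_le hst ▸ uIcc_subset_Icc hx hy
  have hgφ : IntervalIntegrable (fun u => g u • φ u) volume s t :=
    hφ.continuousOn_smul (uIcc_of_le hst ▸ hg)
  have hs : s ∈ Icc s t := ⟨le_rfl, hst⟩
  rw [← P.sum_eq_of_add_eq (J := partsIntegral f φ g) (by simp [partsIntegral])
      fun x hx y hy _ => partsIntegral_add_partsIntegral (hgφ.mono_set (hsub hs hx))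
        (hgφ.mono_set (hsub hx hy)),
    ← P.sum_eq_of_add_eq (J := fun x y => ∫ u in x..y, ‖φ u‖) intervalIntegral.integral_same
      fun x hx y hy _ => intervalIntegral.integral_add_adjacent_intervals
        (hφ.norm.mono_set (hsub hs hx)) (hφ.norm.mono_set (hsub hx hy)),
    Finset.mul_sum, ← Finset.sum_sub_distrib]
  refine norm_sum_le_of_le _ fun i hi => ?_
  have hi := Finset.mem_range.1 hi
  have hx := P.pt_mem hi.le
  have hy := P.pt_mem (Nat.succ_le_of_lt hi)
  exact norm_smul_sub_partsIntegral_le (P.pt_lt i hi).le (hφ.mono_set (hsub hx hy))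
    (hf _ hx _ hy) (hg.mono (Icc_subset_Icc hx.1 hy.2)) (hη i hi)

lemma hasYoungIntegral_partsIntegral (hst : s ≤ t) (hφ : IntervalIntegrable φ volume s t)
    (hf : ∀ a ∈ Icc s t, ∀ b ∈ Icc s t, ∫ u in a..b, φ u = f b - f a)
    (hg : ContinuousOn g (Icc s t)) : HasYoungIntegral f g s t (partsIntegral f φ g s t) := by
  intro ε hε
  have hK : 0 ≤ ∫ u in s..t, ‖φ u‖ :=
    intervalIntegral.integral_nonneg hst fun u _ => norm_nonneg _
  set K := ∫ u in s..t, ‖φ u‖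
  obtain ⟨δ, hδ, hgδ⟩ := Metric.uniformContinuousOn_iff.1
    (isCompact_Icc.uniformContinuousOn_of_continuous hg) (ε / (K + 1)) (by positivity)
  refine ⟨δ, hδ, fun P hP => ?_⟩
  have hη : ∀ i < P.n, ∀ u ∈ Icc (P.pt i) (P.pt (i + 1)),
      dist (g u) (g (P.pt (i + 1))) ≤ ε / (K + 1) := fun i hi u hu => by
    have hx := P.pt_mem hi.le
    have hy := P.pt_mem (Nat.succ_le_of_lt hi)
    refine (hgδ u ⟨hx.1.trans hu.1, hu.2.trans hy.2⟩ _ hy ?_).le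
    rw [dist_comm, Real.dist_eq, abs_of_nonneg (sub_nonneg.2 hu.2)]
    linarith [hP i hi, hu.1]
  calc _ ≤ ε / (K + 1) * K := norm_sum_sub_partsIntegral_le hφ hf hg P hη
    _ < ε := by rw [div_mul_eq_mul_div, div_lt_iff₀ (by positivity)]; linarith

end YoungIntegral

section Holder

variable {X : Type*} [NormedAddCommGroup X] {T α : ℝ} {f : ℝ → X}

lemma holderNorm_le {A B : ℝ≥0∞} (hA : ∀ t ∈ Icc 0 T, ‖f t‖ₑ ≤ A)
    (hB : ∀ s ∈ Icc 0 T, ∀ t ∈ Icc 0 T, s < t →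
      ‖f t - f s‖ₑ / ENNReal.ofReal ((t - s) ^ α) ≤ B) : holderNorm T α f ≤ A + B :=
  add_le_add (iSup₂_le hA) <| iSup₂_le fun s hs => iSup₂_le fun t ht => iSup_le (hB s hs t ht)

lemma holderNorm_congr {f' : ℝ → X} (h : EqOn f f' (Icc 0 T)) :
    holderNorm T α f = holderNorm T α f' := by
  unfold holderNorm
  congr 1
  · exact biSup_congr fun t ht => by rw [h ht]
  · exact biSup_congr fun s hs => biSup_congr fun t ht => by rw [h hs, h ht]

lemma holderNorm_add_le (f h : ℝ → X) :
    holderNorm T α (f + h) ≤ holderNorm T α f + holderNorm T α h := by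
  unfold holderNorm
  rw [add_add_add_comm]
  refine holderNorm_le (fun t ht => ?_) fun s hs t ht hst => ?_
  · exact (enorm_add_le _ _).trans
      (add_le_add (le_iSup₂_of_le t ht le_rfl) (le_iSup₂_of_le t ht le_rfl))
  · simp only [Pi.add_apply, add_sub_add_comm]
    refine (ENNReal.div_le_div_right (enorm_add_le _ _) _).trans ?_
    rw [ENNReal.add_div]
    exact add_le_add
      (le_iSup₂_of_le s hs <| le_iSup₂_of_le t ht <| le_iSup_of_le hst le_rfl)
      (le_iSup₂_of_le s hs <| le_iSup₂_of_le t ht <| le_iSup_of_le hst le_rfl)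

lemma holderNorm_le_of_forall_norm_sub_le (hα : 0 ≤ α) {C : ℝ} (hC : 0 ≤ C) (hf₀ : f 0 = 0)
    (hf : ∀ s ∈ Icc 0 T, ∀ t ∈ Icc 0 T, s ≤ t → ‖f t - f s‖ ≤ C * (t - s) ^ α) :
    holderNorm T α f ≤ ENNReal.ofReal (C * T ^ α) + ENNReal.ofReal C := by
  refine holderNorm_le (fun t ht => ?_) fun s hs t ht hst => ENNReal.div_le_of_le_mul ?_
  · have h := hf 0 ⟨le_rfl, ht.1.trans ht.2⟩ t ht ht.1
    rw [hf₀, sub_zero, sub_zero] at h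
    rw [← ofReal_norm]
    exact ENNReal.ofReal_le_ofReal <| h.trans <|
      mul_le_mul_of_nonneg_left (Real.rpow_le_rpow ht.1 ht.2 hα) hC
  · rw [← ENNReal.ofReal_mul hC, ← ofReal_norm]
    exact ENNReal.ofReal_le_ofReal (hf s hs t ht hst.le)

lemma MemHolder.holderOnWith (hα : 0 ≤ α) (hf : MemHolder T α f) :
    HolderOnWith (holderNorm T α f).toNNReal α.toNNReal f (Icc 0 T) := by
  intro s hs t ht
  wlog hst : s < t generalizing s t
  · rcases (not_lt.1 hst).eq_or_lt with rfl | hts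
    · simp
    · simpa only [edist_comm] using this t ht s hs hts
  have hpos : 0 < (t - s) ^ α := Real.rpow_pos_of_pos (sub_pos.2 hst) α
  have hquot : ‖f t - f s‖ₑ / ENNReal.ofReal ((t - s) ^ α) ≤ holderNorm T α f :=
    le_add_left <| le_iSup₂_of_le s hs <| le_iSup₂_of_le t ht <| le_iSup_of_le hst le_rfl
  rw [ENNReal.div_le_iff (ENNReal.ofReal_pos.2 hpos).ne' ENNReal.ofReal_ne_top,
    ← ENNReal.ofReal_rpow_of_pos (sub_pos.2 hst)] at hquot
  rwa [edist_comm, edist_eq_enorm_sub, ENNReal.coe_toNNReal hf.ne, edist_comm s, edist_dist,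
    Real.dist_eq, abs_of_pos (sub_pos.2 hst), Real.coe_toNNReal α hα]

lemma MemHolder.continuousOn (hα : 0 < α) (hf : MemHolder T α f) : ContinuousOn f (Icc 0 T) :=
  (hf.holderOnWith hα.le).continuousOn (Real.toNNReal_pos.2 hα)

lemma MemHolder.dist_le (hα : 0 ≤ α) (hf : MemHolder T α f) {s t : ℝ} (hs : s ∈ Icc 0 T)
    (ht : t ∈ Icc 0 T) : dist (f s) (f t) ≤ (holderNorm T α f).toReal * dist s t ^ α := by
  have h := (hf.holderOnWith hα).dist_le hs ht
  rwa [Real.coe_toNNReal α hα] at h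

end Holder

section HukuharaDerivative

variable {E : Type*} [NormedAddCommGroup E] [NormedSpace ℝ E] {p T a b t : ℝ}
  {F F₁ F₂ : ℝ → ConvexBody E} {D D₁ D₂ : ConvexBody E}

lemma HasHukuharaDerivAt.add (h₁ : HasHukuharaDerivAt T F₁ t D₁)
    (h₂ : HasHukuharaDerivAt T F₂ t D₂) : HasHukuharaDerivAt T (F₁ + F₂) t (D₁ + D₂) := by
  refine ⟨fun ht => ?_, fun ht => ?_⟩
  · obtain ⟨C₁, hC₁, hl₁⟩ := h₁.1 ht
    obtain ⟨C₂, hC₂, hl₂⟩ := h₂.1 ht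
    refine ⟨C₁ + C₂, ?_, by simpa using tendsto_convexBody_add hl₁ hl₂⟩
    filter_upwards [hC₁, hC₂] with h h₁ h₂
    simp only [Pi.add_apply, h₁, h₂, add_add_add_comm]
  · obtain ⟨C₁, hC₁, hl₁⟩ := h₁.2 ht
    obtain ⟨C₂, hC₂, hl₂⟩ := h₂.2 ht
    refine ⟨C₁ + C₂, ?_, by simpa using tendsto_convexBody_add hl₁ hl₂⟩
    filter_upwards [hC₁, hC₂] with h h₁ h₂
    simp only [Pi.add_apply, h₁, h₂, add_add_add_comm]

lemma HukuharaDifferentiable.add (h₁ : HukuharaDifferentiable T F₁)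
    (h₂ : HukuharaDifferentiable T F₂) : HukuharaDifferentiable T (F₁ + F₂) := fun t ht => by
  obtain ⟨D₁, hD₁⟩ := h₁ t ht
  obtain ⟨D₂, hD₂⟩ := h₂ t ht
  exact ⟨_, hD₁.add hD₂⟩

lemma HukuharaDifferentiable.hasHukuharaDerivAt (h : HukuharaDifferentiable T F)
    (ht : t ∈ Icc 0 T) : HasHukuharaDerivAt T F t (hukuharaDeriv T F t) := by
  rw [hukuharaDeriv, dif_pos (h t ht)]
  exact (h t ht).choose_spec

lemma tendsto_supportFun_sub_div {A B C : ℝ → ConvexBody E}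
    (hC : ∀ᶠ h in 𝓝[>] (0 : ℝ), A h = B h + C h)
    (hl : Tendsto (fun h : ℝ => h⁻¹ • C h) (𝓝[>] 0) (𝓝 D)) (ξ : StrongDual ℝ E) :
    Tendsto (fun h => (supportFun (A h) ξ - supportFun (B h) ξ) / h) (𝓝[>] 0)
      (𝓝 (supportFun D ξ)) := by
  refine (((continuous_supportFun_left ξ).tendsto D).comp hl).congr' ?_
  filter_upwards [hC, self_mem_nhdsWithin] with h hh hpos
  rw [Function.comp_apply, supportFun_smul (inv_pos.2 hpos).le, hh, supportFun_add,
    add_sub_cancel_left, inv_mul_eq_div]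

lemma HasHukuharaDerivAt.hasDerivWithinAt_Ioi (h : HasHukuharaDerivAt T F t D) (ht : t < T)
    (ξ : StrongDual ℝ E) :
    HasDerivWithinAt (fun s => supportFun (F s) ξ) (supportFun D ξ) (Ioi t) t := by
  obtain ⟨C, hC, hl⟩ := h.1 ht
  have hlim : Tendsto (fun y => y - t) (𝓝[>] t) (𝓝[>] 0) := by
    refine tendsto_nhdsWithin_iff.2 ⟨?_, ?_⟩
    · exact ((continuous_sub_right t).tendsto' t 0 (sub_self t)).mono_left nhdsWithin_le_nhds
    · filter_upwards [self_mem_nhdsWithin] with y hy using mem_Ioi.2 (sub_pos.2 (mem_Ioi.1 hy))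
  rw [hasDerivWithinAt_iff_tendsto_slope' self_notMem_Ioi]
  refine ((tendsto_supportFun_sub_div hC hl ξ).comp hlim).congr fun y => ?_
  rw [Function.comp_apply, add_sub_cancel, slope_def_field]

lemma HasHukuharaDerivAt.hasDerivWithinAt_Iio (h : HasHukuharaDerivAt T F t D) (ht : 0 < t)
    (ξ : StrongDual ℝ E) :
    HasDerivWithinAt (fun s => supportFun (F s) ξ) (supportFun D ξ) (Iio t) t := by
  obtain ⟨C, hC, hl⟩ := h.2 ht
  have hlim : Tendsto (fun y => t - y) (𝓝[<] t) (𝓝[>] 0) := by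
    refine tendsto_nhdsWithin_iff.2 ⟨?_, ?_⟩
    · exact ((continuous_sub_left t).tendsto' t 0 (sub_self t)).mono_left nhdsWithin_le_nhds
    · filter_upwards [self_mem_nhdsWithin] with y hy using mem_Ioi.2 (sub_pos.2 (mem_Iio.1 hy))
  rw [hasDerivWithinAt_iff_tendsto_slope' self_notMem_Iio]
  refine ((tendsto_supportFun_sub_div hC hl ξ).comp hlim).congr fun y => ?_
  rw [Function.comp_apply, sub_sub_cancel, slope_comm, slope_def_field]

lemma HasHukuharaDerivAt.hasDerivWithinAt (h : HasHukuharaDerivAt T F t D) (ht : t ∈ Icc 0 T)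
    (ξ : StrongDual ℝ E) :
    HasDerivWithinAt (fun s => supportFun (F s) ξ) (supportFun D ξ) (Icc 0 T) t := by
  rw [← Icc_union_Icc_eq_Icc ht.1 ht.2]
  refine HasDerivWithinAt.union ?_ ?_
  · rcases ht.1.eq_or_lt with rfl | h₀
    · exact HasFDerivWithinAt.of_subsingleton (subsingleton_Icc_of_ge le_rfl)
    · exact (h.hasDerivWithinAt_Iio h₀ ξ).Iic_of_Iio.mono Icc_subset_Iic_self
  · rcases ht.2.eq_or_lt with rfl | hT
    · exact HasFDerivWithinAt.of_subsingleton (subsingleton_Icc_of_ge le_rfl)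
    · exact (h.hasDerivWithinAt_Ioi hT ξ).Ici_of_Ioi.mono Icc_subset_Ici_self

lemma HasHukuharaDerivAt.hasDerivAt (h : HasHukuharaDerivAt T F t D) (ht : t ∈ Ioo 0 T)
    (ξ : StrongDual ℝ E) : HasDerivAt (fun s => supportFun (F s) ξ) (supportFun D ξ) t :=
  (h.hasDerivWithinAt (Ioo_subset_Icc_self ht) ξ).hasDerivAt (Icc_mem_nhds ht.1 ht.2)

lemma HukuharaDifferentiable.hukuharaDeriv_add (h₁ : HukuharaDifferentiable T F₁)
    (h₂ : HukuharaDifferentiable T F₂) (ht : t ∈ Ioo 0 T) :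
    hukuharaDeriv T (F₁ + F₂) t = hukuharaDeriv T F₁ t + hukuharaDeriv T F₂ t := by
  have ht' := Ioo_subset_Icc_self ht
  refine eq_of_forall_supportFun_eq fun ξ => ?_
  exact (((h₁.add h₂).hasHukuharaDerivAt ht').hasDerivAt ht ξ).unique
    (((h₁.hasHukuharaDerivAt ht').add (h₂.hasHukuharaDerivAt ht')).hasDerivAt ht ξ)

lemma HukuharaDifferentiable.deriv_supportFun (h : HukuharaDifferentiable T F) (ht : t ∈ Ioo 0 T)
    (ξ : StrongDual ℝ E) :
    deriv (fun s => supportFun (F s) ξ) t = supportFun (hukuharaDeriv T F t) ξ :=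
  ((h.hasHukuharaDerivAt (Ioo_subset_Icc_self ht)).hasDerivAt ht ξ).deriv

lemma ae_mem_Ioo_of_restrict_Icc (a b : ℝ) : ∀ᵐ t ∂(volume.restrict (Icc a b)), t ∈ Ioo a b := by
  rw [← restrict_Ioo_eq_restrict_Icc]
  exact ae_restrict_mem measurableSet_Ioo

lemma HukuharaDifferentiable.memLp_supportFun (h : HukuharaDifferentiable T F)
    (hb : PIntegrablyBounded p T (hukuharaDeriv T F)) (ξ : StrongDual ℝ E) :
    MemLp (fun t => supportFun (hukuharaDeriv T F t) ξ) (ENNReal.ofReal p)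
      (volume.restrict (Icc 0 T)) := by
  obtain ⟨k, hk, hFk⟩ := hb
  refine (hk.mul_const ‖ξ‖).of_le ?_ ?_
  · refine (measurable_deriv fun s => supportFun (F s) ξ).aestronglyMeasurable.congr ?_
    filter_upwards [ae_mem_Ioo_of_restrict_Icc 0 T] with t ht using h.deriv_supportFun ht ξ
  · filter_upwards [hFk] with t ht
    exact (abs_supportFun_le _ ξ).trans <|
      (mul_le_mul_of_nonneg_right ht (norm_nonneg ξ)).trans (le_abs_self _)

lemma HukuharaDifferentiable.integral_supportFun_eq_sub (hp : 1 ≤ p)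
    (h : HukuharaDifferentiable T F) (hb : PIntegrablyBounded p T (hukuharaDeriv T F))
    (ξ : StrongDual ℝ E) (ha : a ∈ Icc 0 T) (hb' : b ∈ Icc 0 T) (hab : a ≤ b) :
    ∫ t in a..b, supportFun (hukuharaDeriv T F t) ξ = supportFun (F b) ξ - supportFun (F a) ξ := by
  have hcont : ContinuousOn (fun s => supportFun (F s) ξ) (Icc 0 T) := fun t ht =>
    ((h.hasHukuharaDerivAt ht).hasDerivWithinAt ht ξ).continuousWithinAt
  refine intervalIntegral.integral_eq_sub_of_hasDerivAt_of_le (f := fun s => supportFun (F s) ξ)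
    hab (hcont.mono (Icc_subset_Icc ha.1 hb'.2)) (fun t ht => ?_)
    (intervalIntegrable_of_memLp hp (h.memLp_supportFun hb ξ) ha hb')
  have ht' : t ∈ Ioo 0 T := ⟨ha.1.trans_lt ht.1, ht.2.trans_le hb'.2⟩
  exact (h.hasHukuharaDerivAt (Ioo_subset_Icc_self ht')).hasDerivAt ht' ξ

lemma HukuharaDifferentiable.dist_le_integral (hp : 1 ≤ p) (h : HukuharaDifferentiable T F)
    {k : ℝ → ℝ} (hk : MemLp k (ENNReal.ofReal p) (volume.restrict (Icc 0 T)))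
    (hFk : ∀ᵐ t ∂(volume.restrict (Icc 0 T)), dist (hukuharaDeriv T F t) 0 ≤ k t)
    (ha : a ∈ Icc 0 T) (hb : b ∈ Icc 0 T) (hab : a ≤ b) :
    dist (F a) (F b) ≤ ∫ t in a..b, k t := by
  have hFk' := ae_restrict_of_ae_restrict_of_subset
    (Ioc_subset_Icc_self.trans (Icc_subset_Icc ha.1 hb.2)) hFk
  have hk₀ : 0 ≤ ∫ t in a..b, k t := intervalIntegral.integral_nonneg_of_ae_restrict hab <| by
    rw [← restrict_Ioc_eq_restrict_Icc]
    filter_upwards [hFk'] with t ht using dist_nonneg.trans ht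
  rw [dist_comm]
  refine (dist_le_iff_forall_abs_supportFun_sub_le hk₀).2 fun ξ => ?_
  rw [← h.integral_supportFun_eq_sub hp ⟨k, hk, hFk⟩ ξ ha hb hab,
    ← intervalIntegral.integral_mul_const, ← Real.norm_eq_abs]
  refine intervalIntegral.norm_integral_le_of_norm_le hab ?_
    ((intervalIntegrable_of_memLp hp hk ha hb).mul_const ‖ξ‖)
  refine (ae_restrict_iff' measurableSet_Ioc).1 ?_
  filter_upwards [hFk'] with t ht
  exact (abs_supportFun_le _ ξ).trans (mul_le_mul_of_nonneg_right ht (norm_nonneg ξ))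

lemma HukuharaDifferentiable.memBV (hp : 1 ≤ p) (h : HukuharaDifferentiable T F)
    (hb : PIntegrablyBounded p T (hukuharaDeriv T F)) : MemBV p T F := by
  obtain ⟨k, hk, hFk⟩ := hb
  refine MemBV.of_edist_le_lintegral hp hk fun a ha b hb hab => ?_
  rw [edist_dist]
  calc ENNReal.ofReal (dist (F a) (F b)) ≤ ENNReal.ofReal ‖∫ t in Ioc a b, k t‖ := by
        rw [← intervalIntegral.integral_of_le hab]
        exact ENNReal.ofReal_le_ofReal
          ((h.dist_le_integral hp hk hFk ha hb hab).trans (Real.le_norm_self _))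
    _ = ‖∫ t in Ioc a b, k t‖ₑ := ofReal_norm _
    _ ≤ ∫⁻ t in Ioc a b, ‖k t‖ₑ := enorm_integral_le_lintegral_enorm _

lemma HukuharaDifferentiable.add_integral_mem [CompleteSpace E] (hp : 1 ≤ p)
    (h : HukuharaDifferentiable T F) (hb : PIntegrablyBounded p T (hukuharaDeriv T F)) {φ : ℝ → E}
    (hφ : φ ∈ selL p T (hukuharaDeriv T F)) {x : E} (hx : x ∈ F 0) (ht : t ∈ Icc 0 T) :
    x + ∫ u in (0 : ℝ)..t, φ u ∈ F t := by
  have h₀ : (0 : ℝ) ∈ Icc 0 T := ⟨le_rfl, ht.1.trans ht.2⟩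
  refine mem_iff_forall_dual_le_supportFun.2 fun ξ => ?_
  have hint : ξ (∫ u in (0 : ℝ)..t, φ u) ≤ supportFun (F t) ξ - supportFun (F 0) ξ := by
    rw [← h.integral_supportFun_eq_sub hp hb ξ h₀ ht ht.1,
      ← ξ.intervalIntegral_comp_comm (intervalIntegrable_of_memLp hp hφ.1 h₀ ht)]
    refine intervalIntegral.integral_mono_ae_restrict ht.1
      (intervalIntegrable_of_memLp hp (ξ.comp_memLp' hφ.1) h₀ ht)
      (intervalIntegrable_of_memLp hp (h.memLp_supportFun hb ξ) h₀ ht) ?_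
    filter_upwards [ae_restrict_of_ae_restrict_of_subset (Icc_subset_Icc le_rfl ht.2) hφ.2]
      with u hu using le_supportFun ξ hu
  rw [map_add]
  linarith [le_supportFun ξ hx]

lemma PIntegrablyBounded.memLp {Φ : ℝ → ConvexBody E} (hΦ : PIntegrablyBounded p T Φ) {φ : ℝ → E}
    (hφ : AEStronglyMeasurable φ (volume.restrict (Icc 0 T)))
    (hmem : ∀ᵐ t ∂(volume.restrict (Icc 0 T)), φ t ∈ Φ t) :
    MemLp φ (ENNReal.ofReal p) (volume.restrict (Icc 0 T)) := by
  obtain ⟨k, hk, hΦk⟩ := hΦ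
  refine hk.of_le hφ ?_
  filter_upwards [hΦk, hmem] with t h₁ h₂
  exact (norm_le_dist_zero h₂).trans (h₁.trans (le_abs_self _))

end HukuharaDerivative

section SelectionsOfSums

variable {E : Type*} [NormedAddCommGroup E] [NormedSpace ℝ E] {p T : ℝ}
  {F F₁ F₂ : ℝ → ConvexBody E}

lemma mem_selL_of_ae_eq {Φ : ℝ → ConvexBody E} {φ ψ : ℝ → E} (hφ : φ ∈ selL p T Φ)
    (h : φ =ᵐ[volume.restrict (Icc 0 T)] ψ) : ψ ∈ selL p T Φ := by
  refine ⟨hφ.1.ae_eq h, ?_⟩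
  filter_upwards [hφ.2, h] with t ht hφψ
  rwa [← hφψ]

variable [FiniteDimensional ℝ E]

lemma add_mem_IS (hp : 1 < p) (hT : 0 ≤ T) (hd₁ : HukuharaDifferentiable T F₁)
    (hd₂ : HukuharaDifferentiable T F₂) {f₁ f₂ : ℝ → E} (hf₁ : f₁ ∈ IS p T F₁)
    (hf₂ : f₂ ∈ IS p T F₂) : f₁ + f₂ ∈ IS p T (F₁ + F₂) := by
  have hderiv : deriv f₁ + deriv f₂ =ᵐ[volume.restrict (Icc 0 T)] deriv (f₁ + f₂) := by
    filter_upwards [hf₁.1.1.ae_differentiableAt hp hT, hf₂.1.1.ae_differentiableAt hp hT]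
      with t h₁ h₂ using (deriv_add h₁ h₂).symm
  refine ⟨⟨hf₁.1.1.of_edist_le_add hp.le hf₂.1.1 fun _ _ => edist_add_add_le _ _ _ _,
    fun t ht => Set.add_mem_add (hf₁.1.2 t ht) (hf₂.1.2 t ht)⟩,
    mem_selL_of_ae_eq ⟨hf₁.2.1.add hf₂.2.1, ?_⟩ hderiv⟩
  filter_upwards [hf₁.2.2, hf₂.2.2, ae_mem_Ioo_of_restrict_Icc 0 T] with t h₁ h₂ ht
  rw [hd₁.hukuharaDeriv_add hd₂ ht]
  exact Set.add_mem_add h₁ h₂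

lemma add_integral_mem_IS (hp : 1 ≤ p) (hT : 0 ≤ T) (hd : HukuharaDifferentiable T F)
    (hb : PIntegrablyBounded p T (hukuharaDeriv T F)) {φ : ℝ → E}
    (hφ : φ ∈ selL p T (hukuharaDeriv T F)) {x : E} (hx : x ∈ F 0) :
    (fun t => x + ∫ u in (0 : ℝ)..t, φ u) ∈ IS p T F := by
  have h₀ : (0 : ℝ) ∈ Icc 0 T := left_mem_Icc.2 hT
  have hderiv : φ =ᵐ[volume.restrict (Icc 0 T)] deriv fun t => x + ∫ u in (0 : ℝ)..t, φ u := by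
    have hlebesgue :=
      (intervalIntegrable_of_memLp hp hφ.1 h₀ (right_mem_Icc.2 hT)).ae_hasDerivAt_integral
    rw [uIcc_of_le hT] at hlebesgue
    refine (ae_restrict_iff' measurableSet_Icc).2 ?_
    filter_upwards [hlebesgue] with t h ht using ((h ht 0 h₀).const_add x).deriv.symm
  exact ⟨⟨MemBV.add_integral hp hφ.1 x, fun t ht => hd.add_integral_mem hp hb hφ hx ht⟩,
    mem_selL_of_ae_eq hφ hderiv⟩

lemma HukuharaDifferentiable.exists_measurable_selection_sub_mem [MeasurableSpace E] [BorelSpace E]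
    (hd₁ : HukuharaDifferentiable T F₁) (hd₂ : HukuharaDifferentiable T F₂) {v : ℝ → E}
    (hv : Measurable v) (hmem : ∀ᵐ t ∂(volume.restrict (Icc 0 T)),
      v t ∈ hukuharaDeriv T F₁ t + hukuharaDeriv T F₂ t) :
    ∃ φ : ℝ → E, Measurable φ ∧ ∀ᵐ t ∂(volume.restrict (Icc 0 T)),
      φ t ∈ hukuharaDeriv T F₁ t ∧ v t - φ t ∈ hukuharaDeriv T F₂ t := by
  obtain ⟨A, hA, hAm, hAv⟩ := (hmem.and (ae_mem_Ioo_of_restrict_Icc 0 T)).exists_measurable_mem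
  have hmeas : ∀ {F : ℝ → ConvexBody E}, HukuharaDifferentiable T F → ∀ ξ,
      Measurable fun t : A => supportFun (hukuharaDeriv T F t) ξ := fun {F} hd ξ => by
    simp only [← hd.deriv_supportFun (hAv _ (Subtype.coe_prop _)).2 ξ]
    exact (measurable_deriv fun s => supportFun (F s) ξ).comp measurable_subtype_coe
  obtain ⟨ψ, hψ, hψmem⟩ := exists_measurable_mem_sub_mem (hmeas hd₁) (hmeas hd₂)
    (hv.comp measurable_subtype_coe) fun t => (hAv t t.2).1
  obtain ⟨φ, hφ, hφψ⟩ :=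
    (MeasurableEmbedding.subtype_coe hAm).exists_measurable_extend hψ fun _ => ⟨0⟩
  refine ⟨φ, hφ, ?_⟩
  filter_upwards [hA] with t ht
  have hφt : φ t = ψ ⟨t, ht⟩ := congr_fun hφψ ⟨t, ht⟩
  rw [hφt]
  exact hψmem ⟨t, ht⟩

lemma exists_eqOn_add_of_mem_IS_add (hp : 1 < p) (hT : 0 ≤ T)
    (hd₁ : HukuharaDifferentiable T F₁) (hd₂ : HukuharaDifferentiable T F₂)
    (hb₁ : PIntegrablyBounded p T (hukuharaDeriv T F₁))
    (hb₂ : PIntegrablyBounded p T (hukuharaDeriv T F₂)) {f : ℝ → E}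
    (hf : f ∈ IS p T (F₁ + F₂)) :
    ∃ f₁ ∈ IS p T F₁, ∃ f₂ ∈ IS p T F₂, EqOn f (f₁ + f₂) (Icc 0 T) := by
  borelize E
  have h₀ : (0 : ℝ) ∈ Icc 0 T := left_mem_Icc.2 hT
  obtain ⟨x₁, hx₁, x₂, hx₂, hx⟩ := hf.1.2 0 h₀
  have hmem : ∀ᵐ t ∂(volume.restrict (Icc 0 T)),
      deriv f t ∈ hukuharaDeriv T F₁ t + hukuharaDeriv T F₂ t := by
    filter_upwards [hf.2.2, ae_mem_Ioo_of_restrict_Icc 0 T] with t ht hIoo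
    rwa [← hd₁.hukuharaDeriv_add hd₂ hIoo]
  obtain ⟨φ, hφm, hφ⟩ := hd₁.exists_measurable_selection_sub_mem hd₂ (measurable_deriv f) hmem
  have hφ₁ : φ ∈ selL p T (hukuharaDeriv T F₁) :=
    ⟨hb₁.memLp hφm.aestronglyMeasurable (hφ.mono fun t h => h.1), hφ.mono fun t h => h.1⟩
  have hφ₂ : deriv f - φ ∈ selL p T (hukuharaDeriv T F₂) :=
    ⟨hf.2.1.sub hφ₁.1, hφ.mono fun t h => h.2⟩
  refine ⟨_, add_integral_mem_IS hp.le hT hd₁ hb₁ hφ₁ hx₁, _,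
    add_integral_mem_IS hp.le hT hd₂ hb₂ hφ₂ hx₂, fun t ht => ?_⟩
  calc f t = x₁ + x₂ + ∫ u in (0 : ℝ)..t, deriv f u := by
        rw [hf.1.1.integral_deriv_eq_sub hp hf.2.1 h₀ ht, ← hx]
        exact (add_sub_cancel _ _).symm
    _ = x₁ + x₂ + ((∫ u in (0 : ℝ)..t, φ u) + ∫ u in (0 : ℝ)..t, (deriv f - φ) u) := by
        rw [← intervalIntegral.integral_add (intervalIntegrable_of_memLp hp.le hφ₁.1 h₀ ht)
          (intervalIntegrable_of_memLp hp.le hφ₂.1 h₀ ht)]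
        simp only [Pi.sub_apply, add_sub_cancel]
    _ = _ := add_add_add_comm _ _ _ _

end SelectionsOfSums

section YoungIntegralOfSelections

lemma closure_add_eq_of_isBounded {E : Type*} [NormedAddCommGroup E] [ProperSpace E] {S₁ S₂ : Set E}
    (h₁ : Bornology.IsBounded S₁) (h₂ : Bornology.IsBounded S₂) :
    closure (S₁ + S₂) = closure S₁ + closure S₂ := by
  refine Subset.antisymm ?_ ?_
  · exact closure_minimal (Set.add_subset_add subset_closure subset_closure)
      (h₁.isCompact_closure.add h₂.isCompact_closure).isClosed
  · rintro _ ⟨a, ha, b, hb, rfl⟩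
    exact map_mem_closure₂ continuous_add ha hb fun a ha b hb => Set.add_mem_add ha hb

variable {E : Type*} [NormedAddCommGroup E] [NormedSpace ℝ E] [FiniteDimensional ℝ E]
  {p T α s t : ℝ} {F F₁ F₂ : ℝ → ConvexBody E} {g : ℝ → ℝ}

lemma hasYoungIntegral_of_mem_IS (hp : 1 < p) (hg : ContinuousOn g (Icc 0 T)) {f : ℝ → E}
    (hf : f ∈ IS p T F) (hs : 0 ≤ s) (hst : s ≤ t) (ht : t ≤ T) :
    HasYoungIntegral f g s t (partsIntegral f (deriv f) g s t) := by
  have hsub : Icc s t ⊆ Icc 0 T := Icc_subset_Icc hs ht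
  exact hasYoungIntegral_partsIntegral hst
    (intervalIntegrable_of_memLp hp.le hf.2.1 (hsub (left_mem_Icc.2 hst))
      (hsub (right_mem_Icc.2 hst)))
    (fun a ha b hb => hf.1.1.integral_deriv_eq_sub hp hf.2.1 (hsub ha) (hsub hb)) (hg.mono hsub)

lemma exists_norm_add_integral_norm_deriv_le (hp : 1 < p)
    (hb : PIntegrablyBounded p T (hukuharaDeriv T F)) :
    ∃ B : ℝ, ∀ f ∈ IS p T F, ∀ s t, 0 ≤ s → s ≤ t → t ≤ T →
      ‖f s‖ + ∫ u in s..t, ‖deriv f u‖ ≤ B := by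
  obtain ⟨k, hk, hFk⟩ := hb
  refine ⟨dist (F 0) 0 + ∫ u in (0 : ℝ)..T, k u, fun f hf s t hs hst ht => ?_⟩
  have hT : 0 ≤ T := hs.trans (hst.trans ht)
  have h₀ : (0 : ℝ) ∈ Icc 0 T := left_mem_Icc.2 hT
  have hT' : T ∈ Icc 0 T := right_mem_Icc.2 hT
  have hs' : s ∈ Icc 0 T := ⟨hs, hst.trans ht⟩
  have ht' : t ∈ Icc 0 T := ⟨hs.trans hst, ht⟩
  have hint : ∀ {a b : ℝ}, a ∈ Icc 0 T → b ∈ Icc 0 T →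
      IntervalIntegrable (fun u => ‖deriv f u‖) volume a b := fun ha hb =>
    (intervalIntegrable_of_memLp hp.le hf.2.1 ha hb).norm
  have hfs : ‖f s‖ ≤ ‖f 0‖ + ∫ u in (0 : ℝ)..s, ‖deriv f u‖ := by
    have hftc : f s = f 0 + ∫ u in (0 : ℝ)..s, deriv f u := by
      rw [hf.1.1.integral_deriv_eq_sub hp hf.2.1 h₀ hs', add_sub_cancel]
    rw [hftc]
    exact norm_add_le_of_le le_rfl (intervalIntegral.norm_integral_le_integral_norm hs)
  have hle_k : ∫ u in (0 : ℝ)..T, ‖deriv f u‖ ≤ ∫ u in (0 : ℝ)..T, k u := by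
    refine intervalIntegral.integral_mono_ae_restrict hT (hint h₀ hT')
      (intervalIntegrable_of_memLp hp.le hk h₀ hT') ?_
    filter_upwards [hFk, hf.2.2] with u h₁ h₂ using (norm_le_dist_zero h₂).trans h₁
  calc ‖f s‖ + ∫ u in s..t, ‖deriv f u‖
      ≤ ‖f 0‖ + (∫ u in (0 : ℝ)..s, ‖deriv f u‖) + ∫ u in s..t, ‖deriv f u‖ := by gcongr
    _ = ‖f 0‖ + ∫ u in (0 : ℝ)..t, ‖deriv f u‖ := by
        rw [add_assoc,
          intervalIntegral.integral_add_adjacent_intervals (hint h₀ hs') (hint hs' ht')]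
    _ ≤ ‖f 0‖ + ∫ u in (0 : ℝ)..T, ‖deriv f u‖ := by
        gcongr
        exact intervalIntegral.integral_mono_interval le_rfl (hs.trans hst) ht
          (.of_forall fun u => norm_nonneg _) (hint h₀ hT')
    _ ≤ dist (F 0) 0 + ∫ u in (0 : ℝ)..T, k u := add_le_add (norm_le_dist_zero (hf.1.2 0 h₀)) hle_k

lemma exists_norm_partsIntegral_le_mul (hp : 1 < p) (hg : ContinuousOn g (Icc 0 T))
    (hb : PIntegrablyBounded p T (hukuharaDeriv T F)) :
    ∃ B : ℝ, 0 ≤ B ∧ ∀ f ∈ IS p T F, ∀ s t η, 0 ≤ s → s ≤ t → t ≤ T →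
      (∀ u ∈ Icc s t, dist (g u) (g t) ≤ η) → ‖partsIntegral f (deriv f) g s t‖ ≤ η * B := by
  obtain ⟨B, hB⟩ := exists_norm_add_integral_norm_deriv_le hp hb
  refine ⟨max B 0, le_max_right _ _, fun f hf s t η hs hst ht hη => ?_⟩
  have hsub : Icc s t ⊆ Icc 0 T := Icc_subset_Icc hs ht
  have hs' := hsub (left_mem_Icc.2 hst)
  have ht' := hsub (right_mem_Icc.2 hst)
  have hη₀ : 0 ≤ η := dist_nonneg.trans (hη t (right_mem_Icc.2 hst))
  calc ‖partsIntegral f (deriv f) g s t‖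
      ≤ η * (‖f s‖ + ∫ u in s..t, ‖deriv f u‖) :=
        norm_partsIntegral_le hst (intervalIntegrable_of_memLp hp.le hf.2.1 hs' ht')
          (hf.1.1.integral_deriv_eq_sub hp hf.2.1 hs' ht') (hg.mono hsub) hη
    _ ≤ η * max B 0 := by
        gcongr
        exact (hB f hf s t hs hst ht).trans (le_max_left _ _)

lemma isBounded_youngIntegrals (hp : 1 < p) (hg : ContinuousOn g (Icc 0 T))
    (hb : PIntegrablyBounded p T (hukuharaDeriv T F)) (hs : 0 ≤ s) (hst : s ≤ t)
    (ht : t ≤ T) : Bornology.IsBounded {I | ∃ f ∈ IS p T F, HasYoungIntegral f g s t I} := by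
  obtain ⟨B, -, hB⟩ := exists_norm_partsIntegral_le_mul hp hg hb
  obtain ⟨η, hη⟩ := Metric.isBounded_iff.1
    (isCompact_Icc.image_of_continuousOn (hg.mono (Icc_subset_Icc hs ht))).isBounded
  refine isBounded_iff_forall_norm_le.2 ⟨η * B, ?_⟩
  rintro I ⟨f, hf, hI⟩
  rw [hI.unique hst (hasYoungIntegral_of_mem_IS hp hg hf hs hst ht)]
  exact hB f hf s t η hs hst ht fun u hu =>
    hη (mem_image_of_mem g hu) (mem_image_of_mem g (right_mem_Icc.2 hst))

lemma exists_norm_partsIntegral_le_rpow (hp : 1 < p) (hα : 0 < α) (hg : MemHolder T α g)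
    (hb : PIntegrablyBounded p T (hukuharaDeriv T F)) :
    ∃ C : ℝ, 0 ≤ C ∧ ∀ f ∈ IS p T F, ∀ s t, 0 ≤ s → s ≤ t → t ≤ T →
      ‖partsIntegral f (deriv f) g s t‖ ≤ C * (t - s) ^ α := by
  obtain ⟨B, hB₀, hB⟩ := exists_norm_partsIntegral_le_mul hp (hg.continuousOn hα) hb
  set G := (holderNorm T α g).toReal
  refine ⟨G * B, by positivity, fun f hf s t hs hst ht => ?_⟩
  rw [mul_right_comm]
  refine hB f hf s t _ hs hst ht fun u hu => ?_
  have hut : dist u t ≤ t - s := by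
    rw [dist_comm, Real.dist_eq, abs_of_nonneg (sub_nonneg.2 hu.2)]
    linarith [hu.1]
  calc dist (g u) (g t) ≤ G * dist u t ^ α :=
        hg.dist_le hα.le ⟨hs.trans hu.1, hu.2.trans ht⟩ ⟨hs.trans hst, ht⟩
    _ ≤ G * (t - s) ^ α := by gcongr

lemma exists_holderNorm_partsIntegral_le (hp : 1 < p) (hα : 0 < α) (hg : MemHolder T α g)
    (hb : PIntegrablyBounded p T (hukuharaDeriv T F)) :
    ∃ M : ℝ≥0∞, M < ⊤ ∧ ∀ f ∈ IS p T F,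
      holderNorm T α (partsIntegral f (deriv f) g 0) ≤ M := by
  obtain ⟨C, hC₀, hC⟩ := exists_norm_partsIntegral_le_rpow hp hα hg hb
  refine ⟨ENNReal.ofReal (C * T ^ α) + ENNReal.ofReal C, by finiteness, fun f hf => ?_⟩
  refine holderNorm_le_of_forall_norm_sub_le hα.le hC₀ (by simp [partsIntegral])
    fun s hs t ht hst => ?_
  have hint : ∀ {a b : ℝ}, a ∈ Icc 0 T → b ∈ Icc 0 T →
      IntervalIntegrable (fun u => g u • deriv f u) volume a b := fun ha hb =>
    (intervalIntegrable_of_memLp hp.le hf.2.1 ha hb).continuousOn_smul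
      ((hg.continuousOn hα).mono (uIcc_subset_Icc ha hb))
  have h₀ : (0 : ℝ) ∈ Icc 0 T := ⟨le_rfl, hs.1.trans hs.2⟩
  rw [← partsIntegral_add_partsIntegral (hint h₀ hs) (hint hs ht), add_sub_cancel_left]
  exact hC f hf s t hs.1 hst ht.2

lemma exists_holderNorm_le_of_mem_setYoungPath (hp : 1 < p) (hα : 0 < α) (hg : MemHolder T α g)
    (hb : PIntegrablyBounded p T (hukuharaDeriv T F)) :
    ∃ M : ℝ≥0∞, M < ⊤ ∧ ∀ h ∈ setYoungPath p T α F g, holderNorm T α h ≤ M := by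
  obtain ⟨M, hM, hle⟩ := exists_holderNorm_partsIntegral_le hp hα hg hb
  refine ⟨1 + M, by finiteness, fun h hh => ?_⟩
  obtain ⟨f, hf, k, hk, hhk⟩ := hh 1 one_pos
  have hkeq : EqOn k (partsIntegral f (deriv f) g 0) (Icc 0 T) := fun t ht =>
    (hk t ht).unique ht.1
      (hasYoungIntegral_of_mem_IS hp (hg.continuousOn hα) hf le_rfl ht.1 ht.2)
  calc holderNorm T α h = holderNorm T α ((h - k) + k) := by rw [sub_add_cancel]
    _ ≤ holderNorm T α (h - k) + holderNorm T α k := holderNorm_add_le _ _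
    _ ≤ 1 + M := add_le_add hhk.le ((holderNorm_congr hkeq).trans_le (hle f hf))

lemma setYoung_add (hp : 1 < p) (hg : ContinuousOn g (Icc 0 T))
    (hd₁ : HukuharaDifferentiable T F₁) (hd₂ : HukuharaDifferentiable T F₂)
    (hb₁ : PIntegrablyBounded p T (hukuharaDeriv T F₁))
    (hb₂ : PIntegrablyBounded p T (hukuharaDeriv T F₂)) (hs : 0 ≤ s) (hst : s ≤ t)
    (ht : t ≤ T) :
    setYoung p T (F₁ + F₂) g s t = setYoung p T F₁ g s t + setYoung p T F₂ g s t := by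
  have hT : 0 ≤ T := hs.trans (hst.trans ht)
  have : ProperSpace E := FiniteDimensional.proper ℝ E
  rw [setYoung, setYoung, setYoung, ← closure_add_eq_of_isBounded
    (isBounded_youngIntegrals hp hg hb₁ hs hst ht)
    (isBounded_youngIntegrals hp hg hb₂ hs hst ht)]
  congr 1
  refine Subset.antisymm ?_ ?_
  · rintro I ⟨f, hf, hI⟩
    obtain ⟨f₁, hf₁, f₂, hf₂, hfeq⟩ := exists_eqOn_add_of_mem_IS_add hp hT hd₁ hd₂ hb₁ hb₂ hf
    have h₁ := hasYoungIntegral_of_mem_IS hp hg hf₁ hs hst ht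
    have h₂ := hasYoungIntegral_of_mem_IS hp hg hf₂ hs hst ht
    rw [(hI.congr (hfeq.mono (Icc_subset_Icc hs ht))).unique hst (h₁.add h₂)]
    exact Set.add_mem_add ⟨f₁, hf₁, h₁⟩ ⟨f₂, hf₂, h₂⟩
  · rintro _ ⟨I₁, ⟨f₁, hf₁, h₁⟩, I₂, ⟨f₂, hf₂, h₂⟩, rfl⟩
    exact ⟨f₁ + f₂, add_mem_IS hp hT hd₁ hd₂ hf₁ hf₂, h₁.add h₂⟩

end YoungIntegralOfSelections

end SetYoung

end

open SetYoung in
theorem theorem7_general {E : Type*} [NormedAddCommGroup E] [NormedSpace ℝ E]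
    [FiniteDimensional ℝ E] {T p α : ℝ} (hp : 1 < p) (hα : 0 < α) {g : ℝ → ℝ}
    (hg : MemHolder T α g) {F F₁ F₂ : ℝ → ConvexBody E} (hdF : HukuharaDifferentiable T F)
    (hdF₁ : HukuharaDifferentiable T F₁) (hdF₂ : HukuharaDifferentiable T F₂)
    (hbF : PIntegrablyBounded p T (hukuharaDeriv T F))
    (hbF₁ : PIntegrablyBounded p T (hukuharaDeriv T F₁))
    (hbF₂ : PIntegrablyBounded p T (hukuharaDeriv T F₂)) :
    MemBV p T F ∧
    (∀ f ∈ IS p T F, ∀ s t : ℝ, 0 ≤ s → s ≤ t → t ≤ T → ∃ I, HasYoungIntegral f g s t I) ∧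
    (MemBV p T (F₁ + F₂) ∧ HukuharaDifferentiable T (F₁ + F₂)) ∧
    (∀ s t : ℝ, 0 ≤ s → s ≤ t → t ≤ T →
      setYoung p T (F₁ + F₂) g s t = setYoung p T F₁ g s t + setYoung p T F₂ g s t) ∧
    (∃ M : ℝ≥0∞, M < ⊤ ∧ ∀ h ∈ setYoungPath p T α F g, holderNorm T α h ≤ M) ∧
    ∀ s t : ℝ, 0 ≤ s → s ≤ t → t ≤ T → Bornology.IsBounded (setYoung p T F g s t) :=
  ⟨hdF.memBV hp.le hbF,
    fun _ hf _ _ hs hst ht =>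
      ⟨_, hasYoungIntegral_of_mem_IS hp (hg.continuousOn hα) hf hs hst ht⟩,
    ⟨(hdF₁.memBV hp.le hbF₁).of_edist_le_add hp.le (hdF₂.memBV hp.le hbF₂) fun _ _ =>
      edist_convexBody_add_add_le _ _ _ _, hdF₁.add hdF₂⟩,
    fun _ _ hs hst ht => setYoung_add hp (hg.continuousOn hα) hdF₁ hdF₂ hbF₁ hbF₂ hs hst ht,
    exists_holderNorm_le_of_mem_setYoungPath hp hα hg hbF,
    fun _ _ hs hst ht => (isBounded_youngIntegrals hp (hg.continuousOn hα) hbF hs hst ht).closure⟩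

open SetYoung in
/-- The first and second conjuncts say that the objects of the theorem are well defined: the Young
integrals exist, and `F₁ + F₂` belongs to the class for which the integral is defined. -/
theorem theorem7 {d : ℕ} {T p α : ℝ} (hT : 0 < T) (hp : 1 < p) (hα : α ≤ 1)
    (hpα : 1 < 1 / p + α) {g : ℝ → ℝ} (hg : MemHolder T α g)
    {F F₁ F₂ : ℝ → ConvexBody (EuclideanSpace ℝ (Fin d))}
    (hF : MemBV p T F) (hF₁ : MemBV p T F₁) (hF₂ : MemBV p T F₂)
    (hdF : HukuharaDifferentiable T F) (hdF₁ : HukuharaDifferentiable T F₁)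
    (hdF₂ : HukuharaDifferentiable T F₂)
    (hbF : PIntegrablyBounded p T (hukuharaDeriv T F))
    (hbF₁ : PIntegrablyBounded p T (hukuharaDeriv T F₁))
    (hbF₂ : PIntegrablyBounded p T (hukuharaDeriv T F₂)) :
    (∀ f ∈ IS p T F, ∀ s t : ℝ, 0 ≤ s → s ≤ t → t ≤ T → ∃ I, HasYoungIntegral f g s t I) ∧
    (MemBV p T (F₁ + F₂) ∧ HukuharaDifferentiable T (F₁ + F₂)) ∧
    (∀ t ∈ Set.Icc 0 T,
      setYoung p T (F₁ + F₂) g 0 t = setYoung p T F₁ g 0 t + setYoung p T F₂ g 0 t) ∧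
    (Bornology.IsBounded (F 0 : Set (EuclideanSpace ℝ (Fin d))) →
      (∃ M : ENNReal, M < ⊤ ∧ ∀ h ∈ setYoungPath p T α F g, holderNorm T α h ≤ M) ∧
      ∀ s t : ℝ, 0 ≤ s → s ≤ t → t ≤ T → Bornology.IsBounded (setYoung p T F g s t)) := by
  have hα₀ : 0 < α := by linarith [(div_lt_one (one_pos.trans hp)).2 hp]
  obtain ⟨-, hex, hadd, hset, hpath, hbdd⟩ :=
    theorem7_general hp hα₀ hg hdF hdF₁ hdF₂ hbF hbF₁ hbF₂
  exact ⟨hex, hadd, fun t ht => hset 0 t le_rfl ht.1 ht.2, fun _ => ⟨hpath, hbdd⟩⟩
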